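/- Let $K$ be an algebraically closed field, $\Gamma$ a finite quiver, and $\Lambda=K\Gamma/I$, where $I$ is a two-sided ideal of the path algebra which contains all paths of sufficiently large length and is contained in the ideal generated by the arrows. Paths are composed from right to left, $J$ is the Jacobson radical of $\Lambda$, and modules are left modules. Let $\mathbb S=(S(0),\dots,S(l))$ with $S(i)=\Lambda e(i)/Je(i)$ for vertices $e(0),\dots,e(l)$, and put $d=l+1$. Let $p=\gamma_l\cdots\gamma_1$, with arrows $\gamma_i:e(i-1)\to e(i)$, be a path through $\mathbb S$, with right subpaths $p_m=\gamma_m\cdots\gamma_1$ ($p_0=e(0)$). A uniserial module $U$ with sequence $\mathbb S$ of consecutive composition factors (from the top down) has mast $p$ if $pU\neq0$. A detour on $p$ is a pair $(\alpha,p_m)$ with an arrow $\alpha$ such that $\alpha p_m\in K\Gamma\setminus I$, $\alpha p_m\ne p_{m+1}$, and the set $I(\alpha,p_m)$ of all $s>m$ such that $p_s$ ends where $\alpha$ ends is non-empty. Let $V_p$ be the set of all tuples $k=(k_i(\alpha,u))_{i\in I(\alpha,u),\,(\alpha,u)\text{ a detour on }p}$ of scalars for which there are a uniserial module $U$ with mast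 $p$ and an element $x=e(0)x$ with $U=\Lambda x$ and $\alpha u x=\sum_{i\in I(\alpha,u)}k_i(\alpha,u)\,p_i x$ for all detours $(\alpha,u)$. A path $q$ starting in $e(0)$ is a route on $p$ if the sequence of vertices through which it passes is a subsequence of $(e(0),\dots,e(l))$. Let $\Phi_p$ send $k\in V_p$ to the isomorphism type of $$\Lambda e(0)\Big/\Big(\sum_{(\alpha,u)\text{ a detour on }p}\Lambda\Big(\alpha u-\sum_{i\in I(\alpha,u)}k_i(\alpha,u)p_i\Big)+\sum_{q\text{ not a route on }p}\Lambda q\Big).$$ Let $\operatorname{mod}_\Lambda^d$ be the variety of $d$-dimensional representations of $\Lambda$, i.e. of the tuples of $d\times d$-matrices, indexed by the vertices and arrows of $\Gamma$, that are the images of the vertices and arrows under a $K$-algebra homomorphism from $\Lambda$ to the $d\times d$-matrices over $K$; $\operatorname{GL}_d$ acts on it by simultaneous conjugation. Let $\operatorname{Rep}\mathbb S\subseteq\operatorname{mod}_\Lambda^d$ be the set of those points for which the corresponding module $K^d$ is uniserial with sequence $\mathbb S$ of consecutive composition factors. **Corollary F.** For each path $p$ through $\mathbb S$, the map $\Phi_p$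 takes its values in the set of isomorphism types of uniserial modules with mast $p$, and its fibres are Zariski-closed subsets of $V_p$. Likewise, the intersection of each $\operatorname{GL}_d$-orbit of $\operatorname{mod}_\Lambda^d$ with $\operatorname{Rep}\mathbb S$ is Zariski-closed in $\operatorname{Rep}\mathbb S$. -/

import Mathlib

open Quiver

noncomputable section

namespace UniserialGeometry

universe u v w

/-! ## The path algebra -/

section PathAlgebraSection

variable (K : Type u) [Field K] (V : Type v) [Quiver.{w} V]

/-- The paths of a quiver (all of them, of arbitrary length `≥ 0`), with their end points. -/
abbrev AllPaths : Type (max v w) := Σ a b : V, Path a b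

/-- The underlying vector space of the path algebra: it has the set of all paths as a basis. -/
def PathAlgebra : Type (max u v w) := AllPaths V →₀ K

instance : AddCommGroup (PathAlgebra K V) := inferInstanceAs (AddCommGroup (AllPaths V →₀ K))

instance : Module K (PathAlgebra K V) := inferInstanceAs (Module K (AllPaths V →₀ K))

/-- The basis of the path algebra that consists of all paths. -/
def pathBasis : Module.Basis (AllPaths V) K (PathAlgebra K V) :=
  Module.Basis.ofRepr (LinearEquiv.refl K (AllPaths V →₀ K))

variable {V} in
/-- The path `q`, as an element of the path algebra. -/
def ofPath {a b : V} (q : Path a b) : PathAlgebra K V := pathBasis K V ⟨a, b, q⟩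

variable [DecidableEq V]

variable {V} in
/-- The product `y x` of two paths: first `x`, then `y`.  It is `0` unless `y` starts where `x`
ends. -/
def pathMul (y x : AllPaths V) : PathAlgebra K V :=
  if h : x.2.1 = y.1 then ofPath K ((x.2.2.cast rfl h).comp y.2.2) else 0

/-- The bilinear extension of the product of paths. -/
def mulHom : PathAlgebra K V →ₗ[K] PathAlgebra K V →ₗ[K] PathAlgebra K V :=
  (pathBasis K V).constr K fun y => (pathBasis K V).constr K fun x => pathMul K y x

instance : Mul (PathAlgebra K V) := ⟨fun f g => mulHom K V f g⟩

instance [Fintype V] : One (PathAlgebra K V) := ⟨∑ a : V, ofPath K (Path.nil : Path a a)⟩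

variable {K V}

theorem mul_def (f g : PathAlgebra K V) : f * g = mulHom K V f g := rfl

theorem one_def [Fintype V] :
    (1 : PathAlgebra K V) = ∑ a : V, ofPath K (Path.nil : Path a a) := rfl

theorem ofPath_mul_eq {a b b' c : V} (q : Path b' c) (p : Path a b) :
    ofPath K q * ofPath K p = pathMul K ⟨b', c, q⟩ ⟨a, b, p⟩ := by
  rw [mul_def, mulHom, ofPath, ofPath, Module.Basis.constr_basis, Module.Basis.constr_basis]

theorem ofPath_mul {a b c : V} (q : Path b c) (p : Path a b) :
    ofPath K q * ofPath K p = ofPath K (p.comp q) := by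
  rw [ofPath_mul_eq, pathMul, dif_pos rfl]
  rfl

theorem ofPath_mul_of_ne {a b b' c : V} (h : b ≠ b') (q : Path b' c) (p : Path a b) :
    ofPath K q * ofPath K p = 0 := by
  rw [ofPath_mul_eq, pathMul, dif_neg h]

theorem induction_on {P : PathAlgebra K V → Prop} (f : PathAlgebra K V)
    (zero : P 0) (add : ∀ f g, P f → P g → P (f + g)) (smul : ∀ (c : K) f, P f → P (c • f))
    (path : ∀ (a b : V) (q : Path a b), P (ofPath K q)) : P f := by
  have hf : f ∈ Submodule.span K (Set.range (pathBasis K V)) := by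
    rw [(pathBasis K V).span_eq]; trivial
  induction hf using Submodule.span_induction with
  | mem x hx => obtain ⟨⟨a, b, q⟩, rfl⟩ := hx; exact path a b q
  | zero => exact zero
  | add x y _ _ hx hy => exact add x y hx hy
  | smul c x _ hx => exact smul c x hx

private theorem left_distrib' (f g h : PathAlgebra K V) : f * (g + h) = f * g + f * h := by
  simp only [mul_def, map_add]

private theorem right_distrib' (f g h : PathAlgebra K V) : (f + g) * h = f * h + g * h := by
  simp only [mul_def, map_add, LinearMap.add_apply]

private theorem zero_mul' (f : PathAlgebra K V) : 0 * f = 0 := by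
  simp only [mul_def, map_zero, LinearMap.zero_apply]

private theorem mul_zero' (f : PathAlgebra K V) : f * 0 = 0 := by
  simp only [mul_def, map_zero]

private theorem smul_mul' (c : K) (f g : PathAlgebra K V) : c • f * g = c • (f * g) := by
  simp only [mul_def, map_smul, LinearMap.smul_apply]

private theorem mul_smul' (c : K) (f g : PathAlgebra K V) : f * c • g = c • (f * g) := by
  simp only [mul_def, map_smul]

private theorem mul_assoc' (f g h : PathAlgebra K V) : f * g * h = f * (g * h) := by
  induction f using induction_on with
  | zero => simp only [zero_mul']
  | add x y hx hy => simp only [right_distrib', hx, hy]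
  | smul c x hx => simp only [smul_mul', hx]
  | path a b q =>
  induction g using induction_on with
  | zero => simp only [zero_mul', mul_zero']
  | add x y hx hy => simp only [right_distrib', left_distrib', hx, hy]
  | smul c x hx => simp only [smul_mul', mul_smul', hx]
  | path a' b' q' =>
  induction h using induction_on with
  | zero => simp only [mul_zero']
  | add x y hx hy => simp only [left_distrib', hx, hy]
  | smul c x hx => simp only [mul_smul', hx]
  | path a'' b'' q'' =>
  by_cases h1 : b' = a
  · subst h1
    by_cases h2 : b'' = a'
    · subst h2
      simp only [ofPath_mul, Path.comp_assoc]
    · rw [ofPath_mul, ofPath_mul_of_ne h2, ofPath_mul_of_ne h2, mul_zero']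
  · rw [ofPath_mul_of_ne h1, zero_mul']
    by_cases h2 : b'' = a'
    · subst h2
      rw [ofPath_mul, ofPath_mul_of_ne h1]
    · rw [ofPath_mul_of_ne h2, mul_zero']

private theorem sum_mul' {ι : Type*} (s : Finset ι) (F : ι → PathAlgebra K V)
    (g : PathAlgebra K V) : (∑ i ∈ s, F i) * g = ∑ i ∈ s, F i * g := by
  simp only [mul_def, map_sum, LinearMap.sum_apply]

private theorem mul_sum' {ι : Type*} (s : Finset ι) (F : ι → PathAlgebra K V)
    (g : PathAlgebra K V) : g * (∑ i ∈ s, F i) = ∑ i ∈ s, g * F i := by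
  simp only [mul_def, map_sum]

private theorem one_mul' [Fintype V] (f : PathAlgebra K V) : 1 * f = f := by
  induction f using induction_on with
  | zero => exact mul_zero' _
  | add x y hx hy => rw [left_distrib', hx, hy]
  | smul c x hx => rw [mul_smul', hx]
  | path a b q =>
    rw [one_def, sum_mul', Finset.sum_eq_single b, ofPath_mul, Path.comp_nil]
    · exact fun c _ hc => ofPath_mul_of_ne hc.symm _ _
    · exact fun h => absurd (Finset.mem_univ b) h

private theorem mul_one' [Fintype V] (f : PathAlgebra K V) : f * 1 = f := by
  induction f using induction_on with
  | zero => exact zero_mul' _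
  | add x y hx hy => rw [right_distrib', hx, hy]
  | smul c x hx => rw [smul_mul', hx]
  | path a b q =>
    rw [one_def, mul_sum', Finset.sum_eq_single a, ofPath_mul, Path.nil_comp]
    · exact fun c _ hc => ofPath_mul_of_ne hc _ _
    · exact fun h => absurd (Finset.mem_univ a) h

instance [Fintype V] : Ring (PathAlgebra K V) :=
  { (inferInstance : AddCommGroup (PathAlgebra K V)) with
    mul := (· * ·)
    one := 1
    left_distrib := left_distrib'
    right_distrib := right_distrib'
    zero_mul := zero_mul'
    mul_zero := mul_zero'
    mul_assoc := mul_assoc'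
    one_mul := one_mul'
    mul_one := mul_one' }

instance [Fintype V] : Algebra K (PathAlgebra K V) :=
  Algebra.ofModule smul_mul' mul_smul'

end PathAlgebraSection

section Main

variable {K : Type u} [Field K] {V : Type v} [Fintype V] [DecidableEq V] [Quiver.{w} V]

/-! ## Paths modulo relations -/

/-- The ideal `I` contains all paths of sufficiently large length and is contained in the ideal
generated by the arrows (i.e. no element of `I` involves a path of length `0`). -/
structure IsRelationIdeal (I : Ideal (PathAlgebra K V)) : Prop where
  long_path_mem : ∃ N : ℕ, ∀ (a b : V) (q : Path a b), N ≤ q.length → ofPath K q ∈ I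
  nil_coeff : ∀ f ∈ I, ∀ a : V, (pathBasis K V).repr f ⟨a, a, Path.nil⟩ = 0

variable (I : Ideal (PathAlgebra K V)) [I.IsTwoSided]

/-- The algebra `Λ = KΓ / I`. -/
abbrev Lam : Type (max u v w) := PathAlgebra K V ⧸ I

/-- The image in `Λ` of a path. -/
def pathΛ {a b : V} (q : Path a b) : Lam I := Ideal.Quotient.mk I (ofPath K q)

/-- The primitive idempotent of `Λ` that belongs to the vertex `a`. -/
def vertexΛ (a : V) : Lam I := pathΛ I (Path.nil : Path a a)

/-- The image in `Λ` of an arrow. -/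
def arrowΛ (α : Total V) : Lam I := pathΛ I α.hom.toPath

/-! ## Uniserial modules -/

/-- The left ideal `Λ a` generated by the vertex `a`. -/
def projΛ (a : V) : Submodule (Lam I) (Lam I) := Submodule.span (Lam I) {vertexΛ I a}

/-- The left ideal `J a`, where `J` is the Jacobson radical of `Λ` and `a` is a vertex. -/
def radΛ (a : V) : Submodule (Lam I) (Lam I) :=
  Submodule.map (LinearMap.toSpanSingleton (Lam I) (Lam I) (vertexΛ I a)) (Ring.jacobson (Lam I))

/-- The simple left module `Λ a / J a` that belongs to the vertex `a`. -/
abbrev SimpleΛ (a : V) : Type (max u v w) := (projΛ I a) ⧸ (radΛ I a).submoduleOf (projΛ I a)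

/-- A module is uniserial if its submodules form a chain. -/
def IsUniserial (R M : Type*) [Ring R] [AddCommGroup M] [Module R M] : Prop :=
  ∀ A B : Submodule R M, A ≤ B ∨ B ≤ A

variable {l : ℕ}

/-- `M` has a composition series with consecutive factors, from the top down,
`S(0), …, S(l)`, where `S(i) = Λ e(i) / J e(i)`. -/
def HasCompositionSequence (e : Fin (l + 1) → V) (M : Type*) [AddCommGroup M] [Module (Lam I) M] :
    Prop :=
  ∃ F : Fin (l + 2) → Submodule (Lam I) M,
    F 0 = ⊤ ∧ F (Fin.last (l + 1)) = ⊥ ∧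
    ∀ i : Fin (l + 1), F i.succ ≤ F i.castSucc ∧
      Nonempty ((F i.castSucc ⧸ (F i.succ).submoduleOf (F i.castSucc)) ≃ₗ[Lam I] SimpleΛ I (e i))

/-- A path of length `l` that passes consecutively through the vertices `e(0), …, e(l)`, given by
its arrows. -/
abbrev PathThrough (e : Fin (l + 1) → V) : Type w := ∀ i : Fin l, e i.castSucc ⟶ e i.succ

variable {e : Fin (l + 1) → V} (p : PathThrough e)

/-- The right subpath `p_m` of length `m` of `p`; it consists of the first `m` arrows of `p`. -/
def subpath (m : Fin (l + 1)) : Path (e 0) (e m) :=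
  Fin.induction (motive := fun m => Path (e 0) (e m)) Path.nil (fun i q => q.cons (p i)) m

/-- `M` is a uniserial module with mast `p`: it is uniserial with sequence `S(0), …, S(l)` of
consecutive composition factors, and `p M ≠ 0`. -/
def IsUniserialWithMast (M : Type*) [AddCommGroup M] [Module (Lam I) M] : Prop :=
  IsUniserial (Lam I) M ∧ HasCompositionSequence I e M ∧
    ∃ z : M, pathΛ I (subpath p (Fin.last l)) • z ≠ 0

/-! ## The variety `V_p` and the map `Φ_p` -/

/-- The set `I(α, p_m)` of all indices `s > m` such that `p_s` ends where `α` ends. -/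
def detourTargets (e : Fin (l + 1) → V) (α : Total V) (m : Fin (l + 1)) : Finset (Fin (l + 1)) :=
  Finset.univ.filter fun s => m < s ∧ e s = α.right

/-- `(α, p_m)` is a detour on `p`: the element `α p_m` of the path algebra is not in `I`, it
differs from `p_{m+1}`, and there is an `s > m` such that `p_s` ends where `α` ends. -/
def IsDetour (α : Total V) (m : Fin (l + 1)) : Prop :=
  ofPath K α.hom.toPath * ofPath K (subpath p m) ∉ I ∧
  (∀ i : Fin l, i.castSucc = m →
    ofPath K α.hom.toPath * ofPath K (subpath p m) ≠ ofPath K (subpath p i.succ)) ∧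
  (detourTargets e α m).Nonempty

/-- The detours on `p`. -/
abbrev Detour : Type (max v w) := {δ : Total V × Fin (l + 1) // IsDetour I p δ.1 δ.2}

/-- The index set of the coordinates `k_i(α, p_m)`. -/
abbrev DetourIndex : Type (max v w) := Σ δ : Detour I p, detourTargets e δ.1.1 δ.1.2

/-- The coordinate tuple `k` describes the module `M`, relative to a top element `z = e(0) z`:
one has `M = Λ z` and `α p_m z = ∑_i k_i(α, p_m) p_i z` for all detours `(α, p_m)`. -/
def Describes (k : DetourIndex I p → K) (M : Type*) [AddCommGroup M] [Module (Lam I) M] : Prop :=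
  ∃ z : M, vertexΛ I (e 0) • z = z ∧ Submodule.span (Lam I) {z} = ⊤ ∧
    ∀ δ : Detour I p,
      (arrowΛ I δ.1.1 * pathΛ I (subpath p δ.1.2)) • z =
        ∑ i : detourTargets e δ.1.1 δ.1.2, (k ⟨δ, i⟩ • pathΛ I (subpath p i.1)) • z

/-- The variety `V_p`: the set of all coordinate tuples of uniserial modules with mast `p`. -/
def VarV : Set (DetourIndex I p → K) :=
  {k | ∃ (M : Type (max u v w)) (_ : AddCommGroup M) (_ : Module (Lam I) M),
    IsUniserialWithMast I p M ∧ Describes I p k M}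

/-- The path `q`, starting in `e(0)`, is a route on `p`: the sequence of vertices through which it
passes consecutively is a subsequence of `e(0), …, e(l)`. -/
def IsRoute (e : Fin (l + 1) → V) {b : V} (q : Path (e 0) b) : Prop :=
  q.vertices.Sublist (List.ofFn e)

/-- The submodule
`∑_{(α,u) detour} Λ (α u - ∑_i k_i(α,u) p_i) + ∑_{q not a route on p} Λ q` of `Λ e(0)`. -/
def relΛ (k : DetourIndex I p → K) : Submodule (Lam I) (Lam I) :=
  Submodule.span (Lam I)
    ({y | ∃ δ : Detour I p, y = arrowΛ I δ.1.1 * pathΛ I (subpath p δ.1.2) -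
        ∑ i : detourTargets e δ.1.1 δ.1.2, k ⟨δ, i⟩ • pathΛ I (subpath p i.1)} ∪
     {y | ∃ (b : V) (q : Path (e 0) b), ¬ IsRoute e q ∧ y = pathΛ I q})

/-- A representative of the isomorphism type `Φ_p(k)`. -/
abbrev PhiModule (k : DetourIndex I p → K) : Type (max u v w) :=
  (projΛ I (e 0)) ⧸ (relΛ I p k).submoduleOf (projΛ I (e 0))

/-- The fibre of `Φ_p : V_p → {isomorphism types}` over the isomorphism type of `U`. -/
def PhiFibre (U : Type*) [AddCommGroup U] [Module (Lam I) U] : Set (DetourIndex I p → K) :=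
  {k | k ∈ VarV I p ∧ Nonempty (PhiModule I p k ≃ₗ[Lam I] U)}

/-! ## The classical varieties of representations -/

/-- The set `Γ*` of all vertices and all arrows. -/
abbrev GammaStar (V : Type v) [Quiver.{w} V] : Type (max v w) := V ⊕ Total V

/-- The image in `Λ` of a vertex or an arrow. -/
def genΛ : GammaStar V → Lam I
  | Sum.inl a => vertexΛ I a
  | Sum.inr α => arrowΛ I α

/-- The coordinates of the affine space in which the points `(x_α)_{α ∈ Γ*}`, tuples of
`d × d`-matrices, live. -/
abbrev RepCoord (V : Type v) [Quiver.{w} V] (d : ℕ) : Type (max v w) :=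
  GammaStar V × Fin d × Fin d

/-- The matrix `x_α` of a point `x`. -/
def matrixAt {d : ℕ} (x : RepCoord V d → K) (α : GammaStar V) : Matrix (Fin d) (Fin d) K :=
  Matrix.of fun i j => x (α, i, j)

/-- The `Λ`-module `K^d` that belongs to an algebra homomorphism from `Λ` to the
`d × d`-matrices. -/
def MatrixModule {d : ℕ} (_φ : Lam I →ₐ[K] Matrix (Fin d) (Fin d) K) : Type u := Fin d → K

instance {d : ℕ} (φ : Lam I →ₐ[K] Matrix (Fin d) (Fin d) K) : AddCommGroup (MatrixModule I φ) :=
  inferInstanceAs (AddCommGroup (Fin d → K))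

instance {d : ℕ} (φ : Lam I →ₐ[K] Matrix (Fin d) (Fin d) K) :
    Module (Lam I) (MatrixModule I φ) :=
  letI : Module (Module.End K (Fin d → K)) (MatrixModule I φ) :=
    inferInstanceAs (Module (Module.End K (Fin d → K)) (Fin d → K))
  Module.compHom (MatrixModule I φ)
    ((Matrix.toLinAlgEquiv' (R := K) (n := Fin d)).toAlgHom.comp φ).toRingHom

/-- The matrices of the point `x` are the images of the vertices and arrows under the algebra
homomorphism `φ` from `Λ` to the `d × d`-matrices. -/
def Represents {d : ℕ} (φ : Lam I →ₐ[K] Matrix (Fin d) (Fin d) K) (x : RepCoord V d → K) : Prop :=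
  ∀ α : GammaStar V, matrixAt x α = φ (genΛ I α)

/-- The variety of `d`-dimensional representations of `Λ`. -/
def ModVar (d : ℕ) : Set (RepCoord V d → K) :=
  {x | ∃ φ : Lam I →ₐ[K] Matrix (Fin d) (Fin d) K, Represents I φ x}

/-- The set `Rep 𝕊` of all points that correspond to uniserial modules with sequence
`S(0), …, S(l)` of consecutive composition factors. -/
def RepS (e : Fin (l + 1) → V) : Set (RepCoord V (l + 1) → K) :=
  {x | ∃ φ : Lam I →ₐ[K] Matrix (Fin (l + 1)) (Fin (l + 1)) K, Represents I φ x ∧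
    IsUniserial (Lam I) (MatrixModule I φ) ∧ HasCompositionSequence I e (MatrixModule I φ)}

/-- The orbit of the point `x` under the action of `GL_d` by simultaneous conjugation. -/
def orbitGL {d : ℕ} (x : RepCoord V d → K) : Set (RepCoord V d → K) :=
  {y | ∃ g : GL (Fin d) K, ∀ α : GammaStar V,
    matrixAt y α = (g : Matrix (Fin d) (Fin d) K) * matrixAt x α *
      ((g⁻¹ : GL (Fin d) K) : Matrix (Fin d) (Fin d) K)}

end Main

/-- `Y` is a Zariski-closed subset of the subspace `X` of the affine space `K^σ`. -/
def IsZariskiClosedIn {K : Type*} [Field K] {σ : Type*} (X Y : Set (σ → K)) : Prop :=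
  ∃ 𝔞 : Ideal (MvPolynomial σ K), Y = X ∩ MvPolynomial.zeroLocus K 𝔞

end UniserialGeometry

end

open UniserialGeometry

/-!
Both closedness statements rest on a numerical criterion for isomorphism. Let `M` and `N` be
uniserial modules of dimension `l + 1` with composition factors of dimension one, and let `F i` be
the submodule of `M` of codimension `i`. If `dim Hom(N, M ⧸ F i) ≥ dim Hom(M, M ⧸ F i)` for all
`i`, then `N ≃ M` (`IsUniserial.nonempty_equiv_of_finrank_hom_le`). Indeed, suppose that the
quotients of `M` and `N` of dimension `i` are isomorphic but those of dimension `i + 1` are not.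
Then every map `N → M ⧸ F (i + 1)` kills the submodule of `N` of codimension `i`, so that these
maps correspond to the maps `M ⧸ F i → M ⧸ F (i + 1)`, and there are fewer of those than maps `M →
M ⧸ F (i + 1)`.

For a fixed module `X`, the space `Hom(N, X)` is the kernel of a linear map that depends
polynomially on the matrices of `N`, so its dimension is upper semicontinuous
(`exists_polynomial_finrank_hom_le`). Hence the orbit of `M` in `Rep 𝕊` is closed
(`isZariskiClosedIn_orbitGL_inter_RepS`).

For the map `Φ_p`, let `M` be uniserial with mast `p` and described by `k` with top element `z`.
The elements `p_i z` are linearly independent, because they lie in different radical layers, and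
paths that are not routes annihilate `z` (`IsLayering.isRoute_of_smul_ne_zero`). On the other hand
the right subpaths `p_i` span `Λ e(0)` modulo the relations attached to `k`
(`exists_sub_sum_subpath_mem_relΛ`). So the module `Φ_p(k)` is `M` (`Describes.nonempty_equiv`),
and in the basis `p_i z` the vertices and arrows have matrices with entries that are polynomials
in `k` (`Describes.exists_represents`). A fibre of `Φ_p` is therefore the preimage of the
intersection of an orbit with `Rep 𝕊` under a polynomial map, and it is closed by the first part.
-/

noncomputable section
namespace UniserialGeometry
universe u v w

/-! ### Comparing uniserial modules by Hom dimensions -/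

section HomCriterion

variable {K R M N X : Type*} [Field K] [Ring R] [Algebra K R]
  [AddCommGroup M] [Module K M] [Module R M] [IsScalarTower K R M]
  [AddCommGroup N] [Module K N] [Module R N] [IsScalarTower K R N]
  [AddCommGroup X] [Module K X] [Module R X] [IsScalarTower K R X]

theorem finite_linearMap [Module.Finite K M] [Module.Finite K X] :
    Module.Finite K (M →ₗ[R] X) :=
  Module.Finite.of_injective (LinearMap.restrictScalarsₗ K R M X K)
    (LinearMap.restrictScalars_injective K)

variable (K X) in
/-- Precomposition with the `R`-linear map `f`, as a `K`-linear map between Hom spaces. -/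
def precomp (f : M →ₗ[R] N) : (N →ₗ[R] X) →ₗ[K] (M →ₗ[R] X) where
  toFun g := g ∘ₗ f
  map_add' _ _ := rfl
  map_smul' _ _ := rfl

omit [Module K M] [IsScalarTower K R M] [Module K N] [IsScalarTower K R N] in
theorem finrank_hom_congr (f : M ≃ₗ[R] N) :
    Module.finrank K (N →ₗ[R] X) = Module.finrank K (M →ₗ[R] X) :=
  LinearEquiv.finrank_eq (LinearEquiv.ofBijective (precomp K X f.toLinearMap)
    ⟨fun g h hgh => by
      ext n
      simpa [precomp] using LinearMap.congr_fun hgh (f.symm n),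
     fun g => ⟨g ∘ₗ f.symm.toLinearMap, by ext m; simp [precomp]⟩⟩)

theorem finrank_quotient_add_finrank_submodule [Module.Finite K M] (A : Submodule R M) :
    Module.finrank K (M ⧸ A) + Module.finrank K A = Module.finrank K M :=
  Submodule.finrank_quotient_add_finrank (A.restrictScalars K)

theorem eq_of_le_of_finrank_quotient_le [Module.Finite K M] {A B : Submodule R M} (h : A ≤ B)
    (hd : Module.finrank K (M ⧸ A) ≤ Module.finrank K (M ⧸ B)) : A = B := by
  have hA := finrank_quotient_add_finrank_submodule (K := K) A
  have hB := finrank_quotient_add_finrank_submodule (K := K) B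
  have : A.restrictScalars K = B.restrictScalars K :=
    Submodule.eq_of_le_of_finrank_le (S₁ := A.restrictScalars K) (S₂ := B.restrictScalars K) h
      (by change Module.finrank K B ≤ Module.finrank K A; omega)
  exact Submodule.restrictScalars_injective K R M this

theorem IsUniserial.eq_of_finrank_quotient_eq [Module.Finite K M] (hM : IsUniserial R M)
    {A B : Submodule R M} (hd : Module.finrank K (M ⧸ A) = Module.finrank K (M ⧸ B)) : A = B := by
  rcases hM A B with h | h
  · exact eq_of_le_of_finrank_quotient_le h hd.le
  · exact (eq_of_le_of_finrank_quotient_le h hd.ge).symm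

/-- The inductive step of the comparison of uniserial modules: `G` has codimension `i`, `F'` and
`G'` have codimension `i + 1`, and `M ⧸ F ≃ N ⧸ G`.  A map `N → M ⧸ F'` with kernel strictly inside
`G` has kernel `G'` and is onto.  If there is no such map, then all maps `N → M ⧸ F'` factor through
`N ⧸ G ≃ M ⧸ F`, so that there are fewer of them than maps `M → M ⧸ F'`, as the projection of `M`
onto `M ⧸ F'` does not factor through `M ⧸ F`. -/
theorem quotient_equiv_succ [Module.Finite K M] [Module.Finite K N] (hN : IsUniserial R N)
    {i : ℕ} {F F' : Submodule R M} {G G' : Submodule R N}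
    (hFF : ¬ F ≤ F')
    (hF' : Module.finrank K (M ⧸ F') = i + 1)
    (hG : Module.finrank K (N ⧸ G) = i) (hG' : Module.finrank K (N ⧸ G') = i + 1)
    (hdim : Module.finrank K (M →ₗ[R] M ⧸ F') ≤ Module.finrank K (N →ₗ[R] M ⧸ F'))
    (E : (M ⧸ F) ≃ₗ[R] (N ⧸ G)) : Nonempty ((N ⧸ G') ≃ₗ[R] (M ⧸ F')) := by
  have := finite_linearMap (K := K) (R := R) (M := M) (X := M ⧸ F')
  have := finite_linearMap (K := K) (R := R) (M := N ⧸ G) (X := M ⧸ F')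
  by_cases hf : ∃ f : N →ₗ[R] M ⧸ F', ¬ G ≤ LinearMap.ker f
  · obtain ⟨f, hf⟩ := hf
    have hle : LinearMap.ker f ≤ G := (hN _ _).resolve_right hf
    have hr : Module.finrank K (N ⧸ LinearMap.ker f) = Module.finrank K (LinearMap.range f) :=
      (f.quotKerEquivRange.restrictScalars K).finrank_eq
    have hr' : Module.finrank K (LinearMap.range f) ≤ i + 1 :=
      hF' ▸ Submodule.finrank_le ((LinearMap.range f).restrictScalars K)
    have hk : i < Module.finrank K (N ⧸ LinearMap.ker f) := by
      by_contra hcon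
      exact hf (eq_of_le_of_finrank_quotient_le (K := K) hle (by omega)).ge
    have hker : LinearMap.ker f = G' :=
      hN.eq_of_finrank_quotient_eq (K := K) (by omega)
    have hrange : LinearMap.range f = ⊤ := by
      have : (LinearMap.range f).restrictScalars K = ⊤ :=
        Submodule.eq_top_of_finrank_eq (by
          change Module.finrank K (LinearMap.range f) = _
          omega)
      exact Submodule.restrictScalars_injective K R _ (by simpa using this)
    subst hker
    exact ⟨f.quotKerEquivOfSurjective (LinearMap.range_eq_top.1 hrange)⟩
  · push Not at hf
    exfalso
    have h1 : Module.finrank K (N →ₗ[R] M ⧸ F') ≤ Module.finrank K (N ⧸ G →ₗ[R] M ⧸ F') :=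
      LinearMap.finrank_le_finrank_of_surjective (f := precomp K _ G.mkQ) fun f =>
        ⟨G.liftQ f (hf f), G.liftQ_mkQ f (hf f)⟩
    have h2 : Module.finrank K (M ⧸ F →ₗ[R] M ⧸ F') < Module.finrank K (M →ₗ[R] M ⧸ F') := by
      have hinj : Function.Injective (precomp K (M ⧸ F') F.mkQ) := fun g h hgh =>
        Submodule.linearMap_qext _ hgh
      rw [← LinearMap.finrank_range_of_inj hinj]
      refine Submodule.finrank_lt fun htop => ?_
      obtain ⟨g, hg⟩ := LinearMap.range_eq_top.1 htop F'.mkQ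
      refine hFF fun m hm => ?_
      have := LinearMap.congr_fun hg m
      rw [← Submodule.Quotient.mk_eq_zero F', ← Submodule.mkQ_apply, ← this]
      simp [precomp, (Submodule.Quotient.mk_eq_zero F).2 hm]
    have h3 := finrank_hom_congr (K := K) (X := M ⧸ F') E
    omega

/-- A uniserial module `N` is isomorphic to a module `M` of the same dimension, with a descending
sequence of submodules of all codimensions, as soon as it has at least as many homomorphisms as `M`
into each of the quotients of `M` by these submodules. -/
theorem IsUniserial.nonempty_equiv_of_finrank_hom_le [Module.Finite K M] [Module.Finite K N]
    (hN : IsUniserial R N) {n : ℕ}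
    (hMn : Module.finrank K M = n) (hNn : Module.finrank K N = n)
    (F : ℕ → Submodule R M) (hF : ∀ i ≤ n, Module.finrank K (M ⧸ F i) = i)
    (hFa : Antitone F)
    (G : ℕ → Submodule R N) (hG : ∀ i ≤ n, Module.finrank K (N ⧸ G i) = i)
    (hdim : ∀ i ≤ n,
      Module.finrank K (M →ₗ[R] M ⧸ F i) ≤ Module.finrank K (N →ₗ[R] M ⧸ F i)) :
    Nonempty (N ≃ₗ[R] M) := by
  have key : ∀ i ≤ n, Nonempty ((N ⧸ G i) ≃ₗ[R] (M ⧸ F i)) := by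
    intro i
    induction i with
    | zero =>
      intro h
      have h1 : Subsingleton (M ⧸ F 0) := Module.finrank_zero_iff.1 (hF 0 h)
      have h2 : Subsingleton (N ⧸ G 0) := Module.finrank_zero_iff.1 (hG 0 h)
      exact ⟨0⟩
    | succ i ih =>
      intro h
      obtain ⟨E⟩ := ih (by omega)
      refine quotient_equiv_succ hN (fun hle => ?_) (hF _ h) (hG i (by omega)) (hG _ h)
        (hdim _ h) E.symm
      have := hF _ h
      rw [(hFa (Nat.le_succ i)).antisymm hle, hF i (by omega)] at this
      omega
  obtain ⟨E⟩ := key n le_rfl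
  have hGb : G n = ⊥ := (eq_of_le_of_finrank_quotient_le (K := K) bot_le (by
    rw [hG n le_rfl, ← hNn, (Submodule.quotEquivOfEqBot (⊥ : Submodule R N) rfl).restrictScalars K
      |>.finrank_eq])).symm
  have hFb : F n = ⊥ := (eq_of_le_of_finrank_quotient_le (K := K) bot_le (by
    rw [hF n le_rfl, ← hMn, (Submodule.quotEquivOfEqBot (⊥ : Submodule R M) rfl).restrictScalars K
      |>.finrank_eq])).symm
  exact ⟨(Submodule.quotEquivOfEqBot _ hGb).symm ≪≫ₗ E ≪≫ₗ Submodule.quotEquivOfEqBot _ hFb⟩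

end HomCriterion

/-! ### Zariski-closed sets and semicontinuity -/

section Zariski
variable {K : Type*} [Field K] {σ τ : Type*}
open MvPolynomial

theorem isZariskiClosedIn_of_separated {X Y : Set (σ → K)} (hYX : Y ⊆ X)
    (h : ∀ x ∈ X, x ∉ Y → ∃ P : MvPolynomial σ K, aeval x P ≠ 0 ∧ ∀ y ∈ Y, aeval y P = 0) :
    IsZariskiClosedIn X Y := by
  refine ⟨vanishingIdeal K Y, Set.Subset.antisymm (fun y hy => ⟨hYX hy, fun P hP => hP y hy⟩) ?_⟩
  rintro x ⟨hx, hx'⟩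
  by_contra hxY
  obtain ⟨P, hP, hPY⟩ := h x hx hxY
  exact hP (hx' P hPY)

theorem isZariskiClosedIn_empty (X : Set (σ → K)) : IsZariskiClosedIn X ∅ :=
  isZariskiClosedIn_of_separated (Set.empty_subset _) fun _ _ _ => ⟨1, by simp, by simp⟩

theorem IsZariskiClosedIn.preimage {X Y : Set (σ → K)} (h : IsZariskiClosedIn X Y)
    (c : σ → MvPolynomial τ K) {X' : Set (τ → K)}
    (hX : ∀ k ∈ X', (fun s => aeval k (c s)) ∈ X) :
    IsZariskiClosedIn X' {k | k ∈ X' ∧ (fun s => aeval k (c s)) ∈ Y} := by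
  obtain ⟨𝔞, rfl⟩ := h
  refine isZariskiClosedIn_of_separated (fun k hk => hk.1) fun k hk hkY => ?_
  have : (fun s => aeval k (c s)) ∉ zeroLocus K 𝔞 := fun h => hkY ⟨hk, hX k hk, h⟩
  rw [mem_zeroLocus_iff] at this
  push Not at this
  obtain ⟨P, hP, hne⟩ := this
  have hcomp : ∀ k : τ → K, aeval k (aeval c P) = aeval (fun s => aeval k (c s)) P := fun k => by
    rw [← comp_aeval_apply]
  refine ⟨aeval c P, by rwa [hcomp], fun y hy => ?_⟩
  rw [hcomp]
  exact hy.2.2 P hP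

/-- The dimension of the kernel of a linear map whose matrix entries are polynomials in `y` is upper
semicontinuous in `y`. -/
theorem exists_polynomial_finrank_ker_le {E F : Type*} [AddCommGroup E] [Module K E]
    [Module.Finite K E] [AddCommGroup F] [Module K F]
    (L : (σ → K) → E →ₗ[K] F)
    (hL : ∀ (v : E) (q : F →ₗ[K] K), ∃ P : MvPolynomial σ K, ∀ y, aeval y P = q (L y v))
    (x : σ → K) :
    ∃ P : MvPolynomial σ K, aeval x P ≠ 0 ∧ ∀ y, aeval y P ≠ 0 →
      Module.finrank K (LinearMap.ker (L y)) ≤ Module.finrank K (LinearMap.ker (L x)) := by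
  obtain ⟨r, hr⟩ : ∃ r, r = Module.finrank K (LinearMap.range (L x)) := ⟨_, rfl⟩
  let b := Module.finBasisOfFinrankEq K (LinearMap.range (L x)) hr.symm
  choose v hv using fun j => (b j).2
  obtain ⟨π, hπ⟩ := (LinearMap.range (L x)).subtype.exists_leftInverse_of_injective
    (Submodule.ker_subtype _)
  -- the `q i (L y (v j))` form a square block of the matrix of `L y`, which is the identity matrix
  -- at `y = x`; the polynomial is its determinant
  let q : Fin r → F →ₗ[K] K := fun i => b.coord i ∘ₗ π
  choose p hp using fun i j => hL (v j) (q i)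
  have hdet : ∀ y, aeval y (Matrix.det (Matrix.of p)) =
      Matrix.det (Matrix.of fun i j => q i (L y (v j))) := fun y => by
    rw [AlgHom.map_det]
    congr 1
    ext i j
    exact hp i j y
  refine ⟨Matrix.det (Matrix.of p), ?_, fun y hy => ?_⟩
  · have h1 : (Matrix.of fun i j => q i (L x (v j))) = 1 := by
      ext i j
      have : π (b j : F) = b j := LinearMap.congr_fun hπ (b j)
      simp [q, hv, this, Matrix.one_apply, Finsupp.single_apply, eq_comm]
    rw [hdet, h1]
    simp
  · rw [hdet] at hy
    have hcol := Matrix.linearIndependent_cols_of_det_ne_zero hy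
    have hli : LinearIndependent K fun j => L y (v j) := by
      refine LinearIndependent.of_comp (LinearMap.pi q) ?_
      exact hcol
    have hspan := finrank_span_eq_card hli
    have hle : Submodule.span K (Set.range fun j => L y (v j)) ≤ LinearMap.range (L y) :=
      Submodule.span_le.2 (by rintro _ ⟨j, rfl⟩; exact ⟨v j, rfl⟩)
    have h1 := Submodule.finrank_mono hle
    have h2 := (L y).finrank_range_add_finrank_ker
    have h3 := (L x).finrank_range_add_finrank_ker
    rw [Fintype.card_fin] at hspan
    omega

end Zariski

/-! ### Paths in `Λ`, and the modules of matrix representations -/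

section Main
variable {K : Type u} [Field K] {V : Type v} [Fintype V] [DecidableEq V] [Quiver.{w} V]
variable (I : Ideal (PathAlgebra K V)) [I.IsTwoSided]

theorem pathΛ_mul {a b c : V} (q : Path b c) (p : Path a b) :
    pathΛ I q * pathΛ I p = pathΛ I (p.comp q) := by
  rw [pathΛ, pathΛ, ← map_mul, ofPath_mul]; rfl

theorem pathΛ_mul_of_ne {a b b' c : V} (h : b ≠ b') (q : Path b' c) (p : Path a b) :
    pathΛ I q * pathΛ I p = 0 := by
  rw [pathΛ, pathΛ, ← map_mul, ofPath_mul_of_ne h, map_zero]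

theorem vertexΛ_mul_pathΛ {a b : V} (p : Path a b) : vertexΛ I b * pathΛ I p = pathΛ I p :=
  pathΛ_mul I _ p

theorem pathΛ_mul_vertexΛ {a b : V} (p : Path a b) : pathΛ I p * vertexΛ I a = pathΛ I p := by
  rw [vertexΛ, pathΛ_mul, Path.nil_comp]

theorem pathΛ_cons {a b c : V} (p : Path a b) (α : b ⟶ c) :
    pathΛ I (p.cons α) = arrowΛ I ⟨b, c, α⟩ * pathΛ I p :=
  (pathΛ_mul I α.toPath p).symm

variable {I} in
theorem lam_induction {P : Lam I → Prop} (x : Lam I) (zero : P 0)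
    (add : ∀ x y, P x → P y → P (x + y)) (smul : ∀ (c : K) x, P x → P (c • x))
    (path : ∀ (a b : V) (q : Path a b), P (pathΛ I q)) : P x := by
  obtain ⟨f, rfl⟩ := Ideal.Quotient.mk_surjective x
  induction f using induction_on with
  | zero =>
    rw [map_zero]; exact zero
  | add x y hx hy => simpa using add _ _ hx hy
  | smul c x hx => exact smul c _ hx
  | path a b q => exact path a b q

section Intertwine
variable {I}
variable {M N : Type*} [AddCommGroup M] [Module K M] [Module (Lam I) M] [IsScalarTower K (Lam I) M]
  [AddCommGroup N] [Module K N] [Module (Lam I) N] [IsScalarTower K (Lam I) N]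

theorem map_smul_of_map_genΛ_smul (f : M →ₗ[K] N)
    (h : ∀ (γ : GammaStar V) (m : M), f (genΛ I γ • m) = genΛ I γ • f m) (x : Lam I) (m : M) :
    f (x • m) = x • f m := by
  induction x using lam_induction generalizing m with
  | zero => simp only [zero_smul, map_zero]
  | add x y hx hy => simp only [add_smul, map_add, hx, hy]
  | smul c x hx => simp only [smul_assoc, map_smul, hx]
  | path a b q =>
    induction q with
    | nil => exact h (Sum.inl a) m
    | cons q α ih => rw [pathΛ_cons, mul_smul, mul_smul, ← ih]; exact h (Sum.inr ⟨_, _, α⟩) _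

/-- A `K`-linear map that commutes with the vertices and the arrows is `Λ`-linear. -/
def linearMapOfGen (f : M →ₗ[K] N)
    (h : ∀ (γ : GammaStar V) (m : M), f (genΛ I γ • m) = genΛ I γ • f m) : M →ₗ[Lam I] N :=
  { f with map_smul' := map_smul_of_map_genΛ_smul f h }

end Intertwine

variable {I} {d : ℕ}

instance (φ : Lam I →ₐ[K] Matrix (Fin d) (Fin d) K) : Module K (MatrixModule I φ) :=
  inferInstanceAs (Module K (Fin d → K))

/-- The identification of the module of `φ` with its underlying vector space `K^d`. -/
def vec (φ : Lam I →ₐ[K] Matrix (Fin d) (Fin d) K) : MatrixModule I φ ≃ₗ[K] (Fin d → K) :=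
  LinearEquiv.refl K (Fin d → K)

theorem vec_smul (φ : Lam I →ₐ[K] Matrix (Fin d) (Fin d) K) (x : Lam I) (m : MatrixModule I φ) :
    vec φ (x • m) = (φ x).mulVec (vec φ m) := rfl

instance (φ : Lam I →ₐ[K] Matrix (Fin d) (Fin d) K) : IsScalarTower K (Lam I) (MatrixModule I φ) :=
  ⟨fun c x m => (vec φ).injective
    (by rw [vec_smul, map_smul, map_smul, vec_smul, Matrix.smul_mulVec])⟩

instance (φ : Lam I →ₐ[K] Matrix (Fin d) (Fin d) K) : Module.Finite K (MatrixModule I φ) :=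
  Module.Finite.equiv (vec φ).symm

theorem finrank_matrixModule (φ : Lam I →ₐ[K] Matrix (Fin d) (Fin d) K) :
    Module.finrank K (MatrixModule I φ) = d := by
  rw [(vec φ).finrank_eq]; simp

/-- Two representations lie in the same orbit if and only if their modules are isomorphic. -/
theorem mem_orbitGL_iff {x y : RepCoord V d → K} {φ ψ : Lam I →ₐ[K] Matrix (Fin d) (Fin d) K}
    (hx : Represents I φ x) (hy : Represents I ψ y) :
    y ∈ orbitGL x ↔ Nonempty (MatrixModule I φ ≃ₗ[Lam I] MatrixModule I ψ) := by
  constructor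
  · rintro ⟨g, hg⟩
    let G : (Fin d → K) ≃ₗ[K] (Fin d → K) := Matrix.GeneralLinearGroup.toLin g |>.toLinearEquiv
    let E : MatrixModule I φ ≃ₗ[K] MatrixModule I ψ := vec φ ≪≫ₗ G ≪≫ₗ (vec ψ).symm
    have hE : ∀ m, vec ψ (E m) = g.1.mulVec (vec φ m) := fun m => rfl
    refine ⟨{ E with map_smul' := map_smul_of_map_genΛ_smul E.toLinearMap fun γ m => ?_ }⟩
    apply (vec ψ).injective
    change vec ψ (E _) = vec ψ (_ • E _)
    rw [hE, vec_smul, vec_smul, hE, ← hx, ← hy, hg]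
    simp [Matrix.mulVec_mulVec, mul_assoc]
  · rintro ⟨E⟩
    let E' : (Fin d → K) ≃ₗ[K] (Fin d → K) := (vec φ).symm ≪≫ₗ E.restrictScalars K ≪≫ₗ vec ψ
    let g : GL (Fin d) K := Matrix.GeneralLinearGroup.toLin.symm
      (LinearMap.GeneralLinearGroup.ofLinearEquiv E')
    have hg : ∀ v, g.1.mulVec v = vec ψ (E ((vec φ).symm v)) := fun v => by
      have : Matrix.GeneralLinearGroup.toLin g = LinearMap.GeneralLinearGroup.ofLinearEquiv E' :=
        MulEquiv.apply_symm_apply _ _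
      have h2 := congrArg (fun f : LinearMap.GeneralLinearGroup K (Fin d → K) => f.1 v) this
      exact h2
    refine ⟨g, fun γ => ?_⟩
    rw [hx, hy]
    have : ψ (genΛ I γ) * g.1 = g.1 * φ (genΛ I γ) := by
      apply Matrix.toLin'.injective
      refine LinearMap.ext fun v => ?_
      simp only [Matrix.toLin'_apply, ← Matrix.mulVec_mulVec, hg]
      rw [← vec_smul, ← map_smul]
      rfl
    rw [← this, mul_assoc, ← Units.val_mul, mul_inv_cancel]
    simp

section Hom
variable (X : Type*) [AddCommGroup X] [Module K X] [Module (Lam I) X] [IsScalarTower K (Lam I) X]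

/-- The linear map whose kernel consists of the `Λ`-linear maps from the module of the point `y`
to `X`. -/
def commutator (y : RepCoord V d → K) :
    ((Fin d → K) →ₗ[K] X) →ₗ[K] (GammaStar V → (Fin d → K) →ₗ[K] X) :=
  LinearMap.pi fun γ => LinearMap.lcomp K X (Matrix.toLin' (matrixAt y γ)) -
    LinearMap.compRight K (M := Fin d → K) (Algebra.lsmul K K X (genΛ I γ))

theorem finrank_hom_eq_finrank_ker_commutator {y : RepCoord V d → K}
    {φ : Lam I →ₐ[K] Matrix (Fin d) (Fin d) K} (hy : Represents I φ y) :
    Module.finrank K (MatrixModule I φ →ₗ[Lam I] X) =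
      Module.finrank K (LinearMap.ker (commutator (I := I) X y)) := by
  let T : (MatrixModule I φ →ₗ[Lam I] X) →ₗ[K] ((Fin d → K) →ₗ[K] X) :=
    { toFun := fun f => f.restrictScalars K ∘ₗ (vec φ).symm.toLinearMap
      map_add' := fun _ _ => rfl
      map_smul' := fun _ _ => rfl }
  have hT : Function.Injective T := fun f g hfg => by
    ext m
    exact LinearMap.congr_fun hfg (vec φ m)
  have hmem : ∀ f : (Fin d → K) →ₗ[K] X, f ∈ LinearMap.ker (commutator (I := I) X y) ↔
      ∀ γ v, f ((φ (genΛ I γ)).mulVec v) = genΛ I γ • f v := fun f => by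
    simp only [LinearMap.mem_ker, commutator, funext_iff, LinearMap.ext_iff, ← hy _]
    simp [sub_eq_zero]
  have hr : LinearMap.range T = LinearMap.ker (commutator (I := I) X y) := by
    ext f
    rw [hmem]
    constructor
    · rintro ⟨f, rfl⟩ γ v
      exact f.map_smul (genΛ I γ) ((vec φ).symm v)
    · intro h
      exact ⟨linearMapOfGen (f ∘ₗ (vec φ).toLinearMap) fun γ m => h γ _, rfl⟩
  rw [← hr, LinearMap.finrank_range_of_inj hT]

open MvPolynomial in
/-- The dimension of the space of homomorphisms from the module of `y` to a fixed module `X` is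
upper semicontinuous in the point `y`. -/
theorem exists_polynomial_finrank_hom_le [∀ a b : V, Finite (a ⟶ b)] [Module.Finite K X]
    {x : RepCoord V d → K}
    {φ : Lam I →ₐ[K] Matrix (Fin d) (Fin d) K} (hx : Represents I φ x) :
    ∃ P : MvPolynomial (RepCoord V d) K, aeval x P ≠ 0 ∧
      ∀ (y : RepCoord V d → K) (ψ : Lam I →ₐ[K] Matrix (Fin d) (Fin d) K), Represents I ψ y →
        aeval y P ≠ 0 → Module.finrank K (MatrixModule I ψ →ₗ[Lam I] X) ≤
          Module.finrank K (MatrixModule I φ →ₗ[Lam I] X) := by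
  have : Finite (Total V) := Finite.of_injective
    (fun α : Total V => (⟨α.left, α.right, α.hom⟩ : Σ a b : V, (a ⟶ b))) (by
      rintro ⟨a, b, f⟩ ⟨a', b', f'⟩ h
      cases h
      rfl)
  have := Fintype.ofFinite (GammaStar V)
  classical
  obtain ⟨P, hP, hle⟩ := exists_polynomial_finrank_ker_le (commutator (I := I) (d := d) X)
    (fun f q => by
      let c : GammaStar V → K := fun γ =>
        q (Pi.single γ (LinearMap.compRight K (M := Fin d → K) (Algebra.lsmul K K X (genΛ I γ)) f))
      let D : RepCoord V d → K := fun s =>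
        q (Pi.single s.1 (f ∘ₗ Matrix.toLin' (Matrix.single s.2.1 s.2.2 1)))
      refine ⟨∑ s, C (D s) * MvPolynomial.X s - ∑ γ, C (c γ), fun y => ?_⟩
      -- the commutator of `f` is linear in the entries of the matrices, up to a constant
      have hdec : commutator (I := I) X y f =
          ∑ s : RepCoord V d, y s •
            (Pi.single s.1 (f ∘ₗ Matrix.toLin' (Matrix.single s.2.1 s.2.2 1))
            : GammaStar V → (Fin d → K) →ₗ[K] X) -
          ∑ γ, Pi.single γ
            (LinearMap.compRight K (M := Fin d → K) (Algebra.lsmul K K X (genΛ I γ)) f) := by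
        rw [Finset.univ_sum_single]
        funext γ
        rw [Pi.sub_apply]
        simp only [commutator, LinearMap.pi_apply, LinearMap.sub_apply]
        congr 1
        rw [Finset.sum_apply, Fintype.sum_prod_type, Finset.sum_eq_single γ]
        · simp only [Pi.smul_apply, Pi.single_eq_same]
          refine LinearMap.ext fun u => ?_
          rw [LinearMap.lcomp_apply]
          conv_lhs => rw [Matrix.matrix_eq_sum_single (matrixAt y γ)]
          simp only [map_sum, LinearMap.sum_apply, Fintype.sum_prod_type]
          refine Finset.sum_congr rfl fun i _ => Finset.sum_congr rfl fun j _ => ?_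
          rw [LinearMap.smul_apply, LinearMap.comp_apply, ← map_smul, ← LinearMap.smul_apply,
            ← map_smul, Matrix.smul_single]
          simp [matrixAt]
        · intro γ' _ hne
          exact Finset.sum_eq_zero fun _ _ => by
            simp [Pi.single_eq_of_ne hne.symm]
        · simp
      rw [hdec]
      simp [D, c, mul_comm]) x
  refine ⟨P, hP, fun y ψ hy hne => ?_⟩
  rw [finrank_hom_eq_finrank_ker_commutator X hy, finrank_hom_eq_finrank_ker_commutator X hx]
  exact hle y hne

end Hom
end Main

/-! ### The radical and the simple modules -/

section Main
variable {K : Type u} [Field K] {V : Type v} [Fintype V] [DecidableEq V] [Quiver.{w} V]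

variable (K V) in
/-- The span of the paths of length at least `n`: the `n`-th power of the arrow ideal. -/
def longSpan (n : ℕ) : Submodule K (PathAlgebra K V) :=
  Submodule.span K {f | ∃ (a b : V) (q : Path a b), n ≤ q.length ∧ f = ofPath K q}

theorem mul_mem_longSpan {m n : ℕ} {f g : PathAlgebra K V} (hf : f ∈ longSpan K V m)
    (hg : g ∈ longSpan K V n) : f * g ∈ longSpan K V (m + n) := by
  induction hf using Submodule.span_induction with
  | zero => rw [zero_mul]; exact zero_mem _
  | add x y _ _ hx hy => rw [add_mul]; exact add_mem hx hy
  | smul c x _ hx => rw [smul_mul_assoc]; exact Submodule.smul_mem _ _ hx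
  | mem x hx =>
  induction hg using Submodule.span_induction with
  | zero => rw [mul_zero]; exact zero_mem _
  | add x y _ _ hx hy => rw [mul_add]; exact add_mem hx hy
  | smul c x _ hx => rw [mul_smul_comm]; exact Submodule.smul_mem _ _ hx
  | mem y hy =>
  obtain ⟨a, b, q, hq, rfl⟩ := hx
  obtain ⟨a', b', q', hq', rfl⟩ := hy
  by_cases h : b' = a
  · subst h
    rw [ofPath_mul]
    exact Submodule.subset_span ⟨_, _, _, by rw [Path.length_comp]; omega, rfl⟩
  · rw [ofPath_mul_of_ne h]
    exact zero_mem _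

theorem mem_longSpan_zero (f : PathAlgebra K V) : f ∈ longSpan K V 0 := by
  induction f using induction_on with
  | zero => exact zero_mem _
  | add x y hx hy => exact add_mem hx hy
  | smul c x hx => exact Submodule.smul_mem _ _ hx
  | path a b q => exact Submodule.subset_span ⟨a, b, q, Nat.zero_le _, rfl⟩

theorem pow_mem_longSpan {f : PathAlgebra K V} (hf : f ∈ longSpan K V 1) (n : ℕ) :
    f ^ n ∈ longSpan K V n := by
  induction n with
  | zero => exact mem_longSpan_zero _
  | succ n ih => rw [pow_succ]; exact mul_mem_longSpan ih hf

variable {I : Ideal (PathAlgebra K V)} [I.IsTwoSided]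

theorem IsRelationIdeal.isNilpotent_mk (hI : IsRelationIdeal I) {f : PathAlgebra K V}
    (hf : f ∈ longSpan K V 1) : IsNilpotent (Ideal.Quotient.mk I f) := by
  obtain ⟨n, hn⟩ := hI.long_path_mem
  refine ⟨n, ?_⟩
  rw [← map_pow, Ideal.Quotient.eq_zero_iff_mem]
  have hle : longSpan K V n ≤ I.restrictScalars K :=
    Submodule.span_le.2 (by rintro _ ⟨a, b, q, hq, rfl⟩; exact hn a b q hq)
  exact hle (pow_mem_longSpan hf n)

theorem IsRelationIdeal.arrowΛ_mem_jacobson (hI : IsRelationIdeal I) (α : Total V) :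
    arrowΛ I α ∈ Ring.jacobson (Lam I) := by
  rw [← Ideal.jacobson_bot, Ideal.mem_jacobson_iff]
  intro y
  obtain ⟨f, rfl⟩ := Ideal.Quotient.mk_surjective y
  have hα : ofPath K α.hom.toPath ∈ longSpan K V 1 :=
    Submodule.subset_span ⟨_, _, _, le_rfl, rfl⟩
  have hf : f * ofPath K α.hom.toPath ∈ longSpan K V 1 := by
    simpa using mul_mem_longSpan (mem_longSpan_zero f) hα
  obtain ⟨z, hz⟩ := (hI.isNilpotent_mk hf).isUnit_add_one.exists_left_inv
  refine ⟨z, ?_⟩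
  rw [Submodule.mem_bot, sub_eq_zero, ← hz, mul_add, mul_one, map_mul, mul_assoc]
  rfl

theorem mem_radΛ {a : V} {x : Lam I} :
    x ∈ radΛ I a ↔ ∃ j ∈ Ring.jacobson (Lam I), j * vertexΛ I a = x := by
  simp [radΛ, Submodule.mem_map]

theorem mem_projΛ {a : V} {x : Lam I} : x ∈ projΛ I a ↔ ∃ y, y * vertexΛ I a = x := by
  simp [projΛ, Submodule.mem_span_singleton]

theorem vertexΛ_mul_self (a : V) : vertexΛ I a * vertexΛ I a = vertexΛ I a :=
  vertexΛ_mul_pathΛ I _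

theorem mul_vertexΛ_of_mem_projΛ {a : V} {x : Lam I} (hx : x ∈ projΛ I a) :
    x * vertexΛ I a = x := by
  obtain ⟨y, rfl⟩ := mem_projΛ.1 hx
  rw [mul_assoc, vertexΛ_mul_self]

theorem pathΛ_mem_projΛ {a b : V} (q : Path a b) : pathΛ I q ∈ projΛ I a :=
  mem_projΛ.2 ⟨_, pathΛ_mul_vertexΛ I q⟩

/-- An element of `Λ a` is a linear combination of paths that start in `a`. -/
theorem projΛ_induction {a : V} {P : Lam I → Prop} {x : Lam I} (hx : x ∈ projΛ I a) (zero : P 0)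
    (add : ∀ x y, P x → P y → P (x + y)) (smul : ∀ (c : K) x, P x → P (c • x))
    (path : ∀ (b : V) (q : Path a b), P (pathΛ I q)) : P x := by
  rw [← mul_vertexΛ_of_mem_projΛ hx]
  clear hx
  induction x using lam_induction with
  | zero => rwa [zero_mul]
  | add x y hx hy => rw [add_mul]; exact add _ _ hx hy
  | smul c x hx => rw [smul_mul_assoc]; exact smul _ _ hx
  | path a' b q =>
    by_cases h : a = a'
    · subst h
      rw [pathΛ_mul_vertexΛ]
      exact path _ _
    · rw [vertexΛ, pathΛ_mul_of_ne I h]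
      exact zero

theorem IsRelationIdeal.arrowΛ_mul_mem_radΛ (hI : IsRelationIdeal I) (α : Total V) {a : V}
    {x : Lam I} (hx : x ∈ projΛ I a) : arrowΛ I α * x ∈ radΛ I a := by
  obtain ⟨y, rfl⟩ := mem_projΛ.1 hx
  exact mem_radΛ.2 ⟨_, Ideal.mul_mem_right y _ (hI.arrowΛ_mem_jacobson α), mul_assoc _ _ _⟩

theorem IsRelationIdeal.exists_sub_smul_vertexΛ_mem_radΛ (hI : IsRelationIdeal I) {a : V}
    {x : Lam I} (hx : x ∈ projΛ I a) : ∃ c : K, x - c • vertexΛ I a ∈ radΛ I a := by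
  have hsmul : ∀ (c : K) {y : Lam I}, y ∈ radΛ I a → c • y ∈ radΛ I a := fun c y hy =>
    ((radΛ I a).restrictScalars K).smul_mem c hy
  refine projΛ_induction (P := fun x => ∃ c : K, x - c • vertexΛ I a ∈ radΛ I a) hx
    ⟨0, by simp⟩ ?_ ?_ ?_
  · rintro x y ⟨c, hc⟩ ⟨c', hc'⟩
    refine ⟨c + c', ?_⟩
    convert add_mem hc hc' using 1
    rw [add_smul]; abel
  · rintro c x ⟨c', hc'⟩
    exact ⟨c * c', by rw [mul_smul, ← smul_sub]; exact hsmul c hc'⟩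
  · intro b q
    cases q with
    | nil => exact ⟨1, by rw [one_smul, vertexΛ, sub_self]; exact zero_mem _⟩
    | cons q α =>
      refine ⟨0, ?_⟩
      rw [zero_smul, sub_zero, pathΛ_cons]
      exact hI.arrowΛ_mul_mem_radΛ _ (pathΛ_mem_projΛ q)

theorem IsRelationIdeal.arrowΛ_smul_simpleΛ (hI : IsRelationIdeal I) (α : Total V) {a : V}
    (s : SimpleΛ I a) : arrowΛ I α • s = 0 := by
  obtain ⟨x, rfl⟩ := Submodule.Quotient.mk_surjective _ s
  rw [← Submodule.Quotient.mk_smul, Submodule.Quotient.mk_eq_zero]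
  exact hI.arrowΛ_mul_mem_radΛ α x.2

/-- The class of the vertex `a` in the simple module `Λ a / J a`. -/
def simpleGen (I : Ideal (PathAlgebra K V)) [I.IsTwoSided] (a : V) : SimpleΛ I a :=
  Submodule.Quotient.mk ⟨vertexΛ I a, Submodule.mem_span_singleton_self _⟩

theorem IsRelationIdeal.exists_eq_smul_simpleGen (hI : IsRelationIdeal I) {a : V}
    (s : SimpleΛ I a) : ∃ c : K, c • simpleGen I a = s := by
  obtain ⟨x, rfl⟩ := Submodule.Quotient.mk_surjective _ s
  obtain ⟨c, hc⟩ := hI.exists_sub_smul_vertexΛ_mem_radΛ x.2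
  refine ⟨c, ((Submodule.Quotient.eq _).2 ?_).symm⟩
  change _ ∈ radΛ I a
  exact hc

theorem IsRelationIdeal.vertexΛ_smul_simpleΛ (hI : IsRelationIdeal I) (b : V) {a : V}
    (s : SimpleΛ I a) : vertexΛ I b • s = if b = a then s else 0 := by
  obtain ⟨c, rfl⟩ := hI.exists_eq_smul_simpleGen s
  have key : vertexΛ I b • simpleGen I a = if b = a then simpleGen I a else 0 := by
    split_ifs with h
    · subst h
      rw [simpleGen, ← Submodule.Quotient.mk_smul]
      congr 1
      exact Subtype.ext (vertexΛ_mul_self b)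
    · rw [simpleGen, ← Submodule.Quotient.mk_smul, Submodule.Quotient.mk_eq_zero]
      have h0 : vertexΛ I b * vertexΛ I a = 0 := pathΛ_mul_of_ne I (Ne.symm h) _ _
      change vertexΛ I b * vertexΛ I a ∈ radΛ I a
      rw [h0]
      exact zero_mem _
  rw [smul_comm, key]
  split_ifs <;> simp

theorem IsRelationIdeal.finrank_simpleΛ_le (hI : IsRelationIdeal I) (a : V) :
    Module.finrank K (SimpleΛ I a) ≤ 1 :=
  finrank_le_one (simpleGen I a) hI.exists_eq_smul_simpleGen

/-! ### Composition sequences -/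

section Filtration
variable {M : Type*} [AddCommGroup M] [Module (Lam I) M] {A B : Submodule (Lam I) M} {a : V}

theorem IsRelationIdeal.arrowΛ_smul_mem (hI : IsRelationIdeal I)
    (E : (A ⧸ B.submoduleOf A) ≃ₗ[Lam I] SimpleΛ I a) (α : Total V) {m : M} (hm : m ∈ A) :
    arrowΛ I α • m ∈ B := by
  have h : E (Submodule.Quotient.mk (arrowΛ I α • ⟨m, hm⟩)) = 0 := by
    rw [Submodule.Quotient.mk_smul, map_smul, hI.arrowΛ_smul_simpleΛ]
  rwa [LinearEquiv.map_eq_zero_iff, Submodule.Quotient.mk_eq_zero] at h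

theorem IsRelationIdeal.mem_of_vertexΛ_smul_eq (hI : IsRelationIdeal I)
    (E : (A ⧸ B.submoduleOf A) ≃ₗ[Lam I] SimpleΛ I a) {b : V} (hb : b ≠ a) {m : M} (hm : m ∈ A)
    (hbm : vertexΛ I b • m = m) : m ∈ B := by
  have h : E (Submodule.Quotient.mk (vertexΛ I b • ⟨m, hm⟩)) = 0 := by
    rw [Submodule.Quotient.mk_smul, map_smul, hI.vertexΛ_smul_simpleΛ, if_neg hb]
  rw [LinearEquiv.map_eq_zero_iff, Submodule.Quotient.mk_eq_zero] at h
  rw [← hbm]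
  exact h

theorem IsRelationIdeal.finrank_le_succ (hI : IsRelationIdeal I) [Module K M]
    [IsScalarTower K (Lam I) M] [Module.Finite K M] (hBA : B ≤ A)
    (E : (A ⧸ B.submoduleOf A) ≃ₗ[Lam I] SimpleΛ I a) :
    Module.finrank K A ≤ Module.finrank K B + 1 := by
  have : Module.Finite K A := inferInstanceAs (Module.Finite K (A.restrictScalars K))
  have h1 := finrank_quotient_add_finrank_submodule (K := K) (B.submoduleOf A)
  have h2 := (E.restrictScalars K).finrank_eq
  have h3 := ((Submodule.submoduleOfEquivOfLe hBA).restrictScalars K).finrank_eq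
  have h4 := hI.finrank_simpleΛ_le a
  omega

/-- A module whose dimension is the length of its composition sequence has a descending sequence
of submodules of all codimensions.  Only the bound `dim S(i) ≤ 1` is needed, since the total
dimension is known. -/
theorem HasCompositionSequence.exists_filtration (hI : IsRelationIdeal I) [Module K M]
    [IsScalarTower K (Lam I) M] [Module.Finite K M] {l : ℕ} {e : Fin (l + 1) → V}
    (h : HasCompositionSequence I e M) (hd : Module.finrank K M = l + 1) :
    ∃ F : ℕ → Submodule (Lam I) M, Antitone F ∧
      ∀ i ≤ l + 1, Module.finrank K (M ⧸ F i) = i := by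
  obtain ⟨F, h0, hlast, hF⟩ := h
  have hanti : Antitone F := Fin.antitone_iff_succ_le.2 fun i => (hF i).1
  have hstep : ∀ i : Fin (l + 1),
      Module.finrank K (F i.castSucc) ≤ Module.finrank K (F i.succ) + 1 := fun i => by
    obtain ⟨hle, ⟨E⟩⟩ := hF i
    exact hI.finrank_le_succ hle E
  have hadd : ∀ i, Module.finrank K (M ⧸ F i) + Module.finrank K (F i) = l + 1 := fun i =>
    hd ▸ finrank_quotient_add_finrank_submodule (F i)
  have hup : ∀ i : Fin (l + 2), Module.finrank K (M ⧸ F i) ≤ i := fun i => by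
    induction i using Fin.induction with
    | zero =>
      rw [h0]
      exact (Module.finrank_zero_of_subsingleton (R := K) (M := M ⧸ (⊤ : Submodule (Lam I) M))).le
    | succ i ih =>
      have := hstep i
      have := hadd i.castSucc
      have := hadd i.succ
      simp only [Fin.val_castSucc, Fin.val_succ] at *
      omega
  have hdown : ∀ i : Fin (l + 2), Module.finrank K (F i) + i ≤ l + 1 := fun i => by
    induction i using Fin.reverseInduction with
    | last =>
      rw [hlast]
      have := Module.finrank_zero_of_subsingleton (R := K) (M := (⊥ : Submodule (Lam I) M))
      simp only [Fin.val_last]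
      omega
    | cast i ih =>
      have := hstep i
      simp only [Fin.val_castSucc, Fin.val_succ] at *
      omega
  refine ⟨fun i => F ⟨min i (l + 1), by omega⟩, fun i j hij => hanti ?_, fun i hi => ?_⟩
  · simp only [Fin.mk_le_mk]
    omega
  · have h1 := hup ⟨min i (l + 1), by omega⟩
    have h2 := hdown ⟨min i (l + 1), by omega⟩
    have h3 := hadd ⟨min i (l + 1), by omega⟩
    simp only at *
    omega

end Filtration

/-! ### Orbits in `Rep 𝕊` -/

omit [Fintype V] [DecidableEq V] in
theorem orbitGL_eq_of_mem {d : ℕ} {x y : RepCoord V d → K} (h : y ∈ orbitGL x) :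
    orbitGL x = orbitGL y := by
  obtain ⟨g, hg⟩ := h
  ext z
  constructor
  · rintro ⟨g', hg'⟩
    refine ⟨g' * g⁻¹, fun γ => ?_⟩
    rw [hg', hg]
    simp [mul_assoc]
  · rintro ⟨g', hg'⟩
    refine ⟨g' * g, fun γ => ?_⟩
    rw [hg', hg]
    simp [mul_assoc]

/-- The orbit of a module `M` in `Rep 𝕊` is cut out by lower bounds for the dimensions of the
spaces of homomorphisms into the quotients of `M`. -/
theorem isZariskiClosedIn_orbitGL_inter_RepS [∀ a b : V, Finite (a ⟶ b)] (hI : IsRelationIdeal I)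
    {l : ℕ} (e : Fin (l + 1) → V) (x : RepCoord V (l + 1) → K) :
    IsZariskiClosedIn (RepS I e) (orbitGL x ∩ RepS I e) := by
  rcases Set.eq_empty_or_nonempty (orbitGL x ∩ RepS I e) with h | ⟨x', hx', hx'S⟩
  · rw [h]
    exact isZariskiClosedIn_empty _
  rw [orbitGL_eq_of_mem hx']
  obtain ⟨φ, hφ, -, hφc⟩ := hx'S
  obtain ⟨F, hFa, hF⟩ := hφc.exists_filtration hI (finrank_matrixModule φ)
  refine isZariskiClosedIn_of_separated Set.inter_subset_right ?_
  rintro y ⟨ψ, hψ, hψu, hψc⟩ hy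
  obtain ⟨G, -, hG⟩ := hψc.exists_filtration hI (finrank_matrixModule ψ)
  obtain ⟨i, hi, hlt⟩ : ∃ i ≤ l + 1,
      Module.finrank K (MatrixModule I ψ →ₗ[Lam I] MatrixModule I φ ⧸ F i) <
        Module.finrank K (MatrixModule I φ →ₗ[Lam I] MatrixModule I φ ⧸ F i) := by
    by_contra! hcon
    obtain ⟨E⟩ := hψu.nonempty_equiv_of_finrank_hom_le (finrank_matrixModule φ)
      (finrank_matrixModule ψ) F hF hFa G hG hcon
    exact hy ⟨(mem_orbitGL_iff hφ hψ).2 ⟨E.symm⟩, ψ, hψ, hψu, hψc⟩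
  obtain ⟨P, hP, hle⟩ := exists_polynomial_finrank_hom_le (MatrixModule I φ ⧸ F i) hψ
  refine ⟨P, hP, ?_⟩
  rintro z ⟨hz, χ, hχ, -, -⟩
  by_contra hne
  have h1 := hle z χ hχ hne
  obtain ⟨E⟩ := (mem_orbitGL_iff hφ hχ).1 hz
  have h2 := finrank_hom_congr (K := K) (X := MatrixModule I φ ⧸ F i) E
  omega

end Main

/-! ### Transport along isomorphisms, and routes -/

section Transfer
variable {R M N : Type*} [Ring R] [AddCommGroup M] [Module R M] [AddCommGroup N] [Module R N]

theorem IsUniserial.of_equiv (hM : IsUniserial R M) (E : M ≃ₗ[R] N) : IsUniserial R N := by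
  intro A B
  rw [← Submodule.comap_le_comap_iff_of_surjective (f := E.toLinearMap) E.surjective,
    ← Submodule.comap_le_comap_iff_of_surjective (f := E.toLinearMap) E.surjective]
  exact hM _ _

end Transfer

section Main
variable {K : Type u} [Field K] {V : Type v} [Fintype V] [DecidableEq V] [Quiver.{w} V]
variable {I : Ideal (PathAlgebra K V)} [I.IsTwoSided] {l : ℕ} {e : Fin (l + 1) → V}

section Transfer
variable {M N : Type*} [AddCommGroup M] [Module (Lam I) M] [AddCommGroup N] [Module (Lam I) N]

theorem HasCompositionSequence.of_equiv (h : HasCompositionSequence I e M) (E : M ≃ₗ[Lam I] N) :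
    HasCompositionSequence I e N := by
  obtain ⟨F, h0, hl, hF⟩ := h
  refine ⟨fun i => (F i).map E.toLinearMap, by simp [h0], by simp [hl], fun i =>
    ⟨Submodule.map_mono (hF i).1, ?_⟩⟩
  obtain ⟨S⟩ := (hF i).2
  refine ⟨LinearEquiv.trans
    (Submodule.Quotient.equiv _ _ (E.submoduleMap (F i.castSucc)) ?_).symm S⟩
  ext ⟨x, hx⟩
  obtain ⟨y, hy, rfl⟩ := hx
  constructor
  · rintro ⟨z, hz, hzx⟩
    exact ⟨z, hz, congrArg Subtype.val hzx⟩
  · rintro ⟨z, hz, hzx⟩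
    refine ⟨⟨y, hy⟩, ?_, rfl⟩
    have : z = y := E.injective hzx
    subst this
    exact hz

theorem IsUniserialWithMast.of_equiv {p : PathThrough e} (h : IsUniserialWithMast I p M)
    (E : M ≃ₗ[Lam I] N) : IsUniserialWithMast I p N := by
  obtain ⟨hu, hc, z, hz⟩ := h
  exact ⟨hu.of_equiv E, hc.of_equiv E, E z, by rwa [← map_smul, Ne, LinearEquiv.map_eq_zero_iff]⟩

end Transfer

omit [Fintype V] [DecidableEq V] in
/-- A route of length `n` ends in a vertex `e(s)` with `s ≥ n`. -/
theorem IsRoute.exists_le {b : V} {q : Path (e 0) b} (h : IsRoute e q) :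
    ∃ s : Fin (l + 1), q.length ≤ s ∧ e s = b := by
  obtain ⟨f, hf⟩ := List.sublist_iff_exists_fin_orderEmbedding_get_eq.1 h
  have hlen : q.vertices.length = q.length + 1 := q.vertices_length
  have hlast := hf ⟨q.length, by omega⟩
  have hle : ∀ (n : ℕ) (hn : n < q.vertices.length), n ≤ f ⟨n, hn⟩ := fun n => by
    induction n with
    | zero => exact fun _ => Nat.zero_le _
    | succ n ih =>
      intro hn
      have h1 := ih (by omega)
      have h2 : f ⟨n, by omega⟩ < f ⟨n + 1, hn⟩ := f.strictMono (by simp)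
      have h3 : (f ⟨n, by omega⟩ : ℕ) < f ⟨n + 1, hn⟩ := h2
      omega
  refine ⟨(f ⟨q.length, by omega⟩).cast (by simp), hle _ _, ?_⟩
  have hq : q.vertices.get ⟨q.length, by omega⟩ = b := by
    have := q.vertices_getLast
    rw [List.getLast_eq_getElem] at this
    simpa [hlen] using this
  exact (List.get_ofFn e _).symm.trans (hlast.symm.trans hq)

/-! ### The module presented by the relations -/

section Coeff
variable (I) (p : PathThrough e)

open Classical MvPolynomial in
/-- The coefficient of `p_i x` in `α p_j x`, for a top element `x` that satisfies the detour
relations with coordinates `k`; it is a coordinate function of `k`, or `1`, or `0`. -/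
def detourCoeff (α : Total V) (j i : Fin (l + 1)) : MvPolynomial (DetourIndex I p) K :=
  if h : IsDetour I p α j ∧ i ∈ detourTargets e α j then X ⟨⟨(α, j), h.1⟩, ⟨i, h.2⟩⟩
  else if ∃ s : Fin l, s.castSucc = j ∧ s.succ = i ∧
      ofPath K α.hom.toPath * ofPath K (subpath p j) = ofPath K (subpath p s.succ) then 1
  else 0

omit [Fintype V] [DecidableEq V] in
theorem subpath_succ (i : Fin l) : subpath p i.succ = (subpath p i.castSucc).cons (p i) := rfl

omit [Fintype V] [DecidableEq V] in
theorem length_subpath (i : Fin (l + 1)) : (subpath p i).length = i := by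
  induction i using Fin.induction with
  | zero => rfl
  | succ i ih => rw [subpath_succ, Path.length_cons, ih]; simp

variable {I p} in
/-- Modulo the relations attached to `k`, each arrow maps the right subpaths of `p` to combinations
of right subpaths.  Apart from the detours and the arrows of `p` itself, the product `α p_j` is `0`
or not a route. -/
theorem arrowΛ_mul_subpath_sub_mem_relΛ (k : DetourIndex I p → K) (α : Total V)
    (j : Fin (l + 1)) :
    arrowΛ I α * pathΛ I (subpath p j) -
      ∑ i, MvPolynomial.aeval k (detourCoeff I p α j i) • pathΛ I (subpath p i) ∈ relΛ I p k := by
  classical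
  by_cases hd : IsDetour I p α j
  · refine Submodule.subset_span (Or.inl ⟨⟨(α, j), hd⟩, ?_⟩)
    congr 1
    rw [← Finset.sum_subset (Finset.subset_univ (detourTargets e α j)), ← Finset.sum_attach]
    · refine Finset.sum_congr rfl fun i _ => ?_
      rw [detourCoeff, dif_pos ⟨hd, i.2⟩, MvPolynomial.aeval_X]
    · intro i _ hi
      rw [detourCoeff, dif_neg fun h => hi h.2, if_neg, map_zero, zero_smul]
      rintro ⟨s, hs, -, h⟩
      exact hd.2.1 s hs h
  · by_cases hs : ∃ s : Fin l, s.castSucc = j ∧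
      ofPath K α.hom.toPath * ofPath K (subpath p j) = ofPath K (subpath p s.succ)
    · obtain ⟨s, rfl, h⟩ := hs
      rw [Finset.sum_eq_single s.succ]
      · rw [detourCoeff, dif_neg fun h => hd h.1, if_pos ⟨s, rfl, rfl, h⟩, map_one, one_smul,
          arrowΛ, pathΛ, pathΛ, ← map_mul, h]
        simp [pathΛ]
      · intro i _ hi
        rw [detourCoeff, dif_neg fun h => hd h.1, if_neg, map_zero, zero_smul]
        rintro ⟨s', hs', h', -⟩
        obtain rfl := Fin.castSucc_injective l hs'
        exact hi h'.symm
      · simp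
    · rw [Finset.sum_eq_zero, sub_zero]
      · obtain ⟨a, b, f⟩ := α
        by_cases ha : e j = a
        · subst ha
          by_cases hI : ofPath K f.toPath * ofPath K (subpath p j) ∈ I
          · have : arrowΛ I ⟨_, _, f⟩ * pathΛ I (subpath p j) = 0 := by
              rw [arrowΛ, pathΛ, pathΛ, ← map_mul, Ideal.Quotient.eq_zero_iff_mem]
              exact hI
            rw [this]
            exact zero_mem _
          · rw [← pathΛ_cons]
            refine Submodule.subset_span (Or.inr ⟨b, _, fun hr => ?_, rfl⟩)
            -- a route of this shape would exhibit a target index, so that `(α, p_j)` is a detour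
            obtain ⟨s, hs1, hs2⟩ := hr.exists_le
            rw [Path.length_cons, length_subpath] at hs1
            refine hd ⟨hI, fun i hi h => hs ⟨i, hi, h⟩, s, ?_⟩
            simp only [detourTargets, Finset.mem_filter, Finset.mem_univ, true_and]
            exact ⟨Fin.lt_def.2 (by omega), hs2⟩
        · rw [arrowΛ, pathΛ_mul_of_ne I ha]
          exact zero_mem _
      · intro i _
        rw [detourCoeff, dif_neg fun h => hd h.1, if_neg, map_zero, zero_smul]
        rintro ⟨s, h1, -, h2⟩
        exact hs ⟨s, h1, h2⟩

variable {I p} in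
/-- Modulo the defining relations, `Λ e(0)` is spanned by the right subpaths of `p`. -/
theorem exists_sub_sum_subpath_mem_relΛ (k : DetourIndex I p → K) {x : Lam I}
    (hx : x ∈ projΛ I (e 0)) :
    ∃ c : Fin (l + 1) → K, x - ∑ i, c i • pathΛ I (subpath p i) ∈ relΛ I p k := by
  let S : Submodule K (Lam I) := Submodule.span K (Set.range fun i => pathΛ I (subpath p i))
  let W : Submodule K (Lam I) := (relΛ I p k).restrictScalars K ⊔ S
  have hS : ∀ i, pathΛ I (subpath p i) ∈ S := fun i => Submodule.subset_span ⟨i, rfl⟩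
  have harrow : ∀ (α : Total V) (x : Lam I), x ∈ W → arrowΛ I α * x ∈ W := fun α => by
    suffices h : W ≤ W.comap (LinearMap.mulLeft K (arrowΛ I α)) from fun x hx => h hx
    refine sup_le (fun x hx => ?_) (Submodule.span_le.2 ?_)
    · exact Submodule.mem_sup_left ((relΛ I p k).smul_mem (arrowΛ I α) hx)
    · rintro _ ⟨j, rfl⟩
      have h1 := arrowΛ_mul_subpath_sub_mem_relΛ k α j
      have h2 : ∑ i, MvPolynomial.aeval k (detourCoeff I p α j i) • pathΛ I (subpath p i) ∈ S :=
        sum_mem fun i _ => S.smul_mem _ (hS i)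
      simpa [W] using add_mem (Submodule.mem_sup_left (S := (relΛ I p k).restrictScalars K) h1)
        (Submodule.mem_sup_right h2)
  have hW : x ∈ W := projΛ_induction (P := fun x => x ∈ W) hx (zero_mem _)
    (fun _ _ hx hy => add_mem hx hy) (fun c _ hx => W.smul_mem c hx) fun b q => by
      induction q with
      | nil => exact Submodule.mem_sup_right (hS 0)
      | cons q α ih => rw [pathΛ_cons]; exact harrow _ _ ih
  obtain ⟨y, hy, z, hz, rfl⟩ := Submodule.mem_sup.1 hW
  obtain ⟨c, rfl⟩ := (Submodule.mem_span_range_iff_exists_fun K).1 hz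
  exact ⟨c, by simpa using hy⟩

/-- The entries of the matrices of vertices and arrows with respect to the basis `p_i x`, as
polynomials in the coordinates `k`. -/
def repCoeff : RepCoord V (l + 1) → MvPolynomial (DetourIndex I p) K
  | (Sum.inl a, i, j) => if i = j ∧ e j = a then 1 else 0
  | (Sum.inr α, i, j) => detourCoeff I p α j i

end Coeff
end Main

section Main
variable {K : Type u} [Field K] {V : Type v} [Fintype V] [DecidableEq V] [Quiver.{w} V]
variable {I : Ideal (PathAlgebra K V)} [I.IsTwoSided] {l : ℕ} {e : Fin (l + 1) → V}

/-! ### The layers of a module with a composition sequence -/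

section Filtration
variable {M : Type*} [AddCommGroup M] [Module (Lam I) M]

/-- A descending filtration of `M` that is shifted by the arrows, and on whose `i`-th factor every
vertex other than `e(i)` acts as zero.  The indices are natural numbers; the filtration ends in
`0` at the index `l + 1`. -/
structure IsLayering (e : Fin (l + 1) → V) (F : ℕ → Submodule (Lam I) M) : Prop where
  zero : F 0 = ⊤
  last : F (l + 1) = ⊥
  antitone : Antitone F
  arrow : ∀ (α : Total V) (i : ℕ) (m : M), m ∈ F i → arrowΛ I α • m ∈ F (i + 1)
  vertex : ∀ (b : V) (i : Fin (l + 1)) (m : M), m ∈ F i → vertexΛ I b • m = m → b ≠ e i →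
    m ∈ F (i + 1)

theorem HasCompositionSequence.exists_isLayering (hI : IsRelationIdeal I)
    (h : HasCompositionSequence I e M) : ∃ F : ℕ → Submodule (Lam I) M, IsLayering e F := by
  obtain ⟨F, h0, hlast, hF⟩ := h
  have hanti : Antitone F := Fin.antitone_iff_succ_le.2 fun i => (hF i).1
  let G : ℕ → Submodule (Lam I) M := fun i => F ⟨min i (l + 1), by omega⟩
  have hG0 : ∀ i : Fin (l + 1), G i = F i.castSucc := fun i => by
    simp only [G]
    congr 1
    ext
    simp only [Fin.val_castSucc]
    omega
  have hG1 : ∀ i : Fin (l + 1), G (i + 1) = F i.succ := fun i => by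
    simp only [G]
    congr 1
    ext
    simp only [Fin.val_succ]
    omega
  refine ⟨G, h0, ?_, fun i j hij => hanti ?_, fun α i m hm => ?_, fun b i m hm hbm hb => ?_⟩
  · rw [← hlast]
    simp only [G]
    congr 1
    ext
    simp
  · simp only [Fin.mk_le_mk]
    omega
  · by_cases hi : i < l + 1
    · lift i to Fin (l + 1) using hi
      rw [hG0] at hm
      rw [hG1]
      exact hI.arrowΛ_smul_mem (hF i).2.some α hm
    · have : G (i + 1) = G i := by
        simp only [G]
        congr 1
        ext
        simp only
        omega
      rw [this]
      exact (G i).smul_mem _ hm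
  · rw [hG0] at hm
    rw [hG1]
    exact hI.mem_of_vertexΛ_smul_eq (hF i).2.some hb hm hbm

namespace IsLayering
variable {F : ℕ → Submodule (Lam I) M} (hF : IsLayering e F)
include hF

theorem pathΛ_smul_mem {a b : V} (q : Path a b) {i : ℕ} {m : M} (hm : m ∈ F i) :
    pathΛ I q • m ∈ F (i + q.length) := by
  induction q with
  | nil => exact (F i).smul_mem _ hm
  | cons q α ih =>
    rw [pathΛ_cons, mul_smul]
    exact hF.arrow _ _ _ ih

theorem exists_index {b : V} {m : M} (hm0 : m ≠ 0) (hb : vertexΛ I b • m = m) {i : ℕ}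
    (hi : i ≤ l + 1) (hm : m ∈ F i) : ∃ j : Fin (l + 1), i ≤ j ∧ e j = b ∧ m ∈ F j := by
  induction hi using Nat.decreasingInduction with
  | self =>
    rw [hF.last] at hm
    exact absurd hm hm0
  | of_succ k hk ih =>
    by_cases hbe : b = e ⟨k, hk⟩
    · exact ⟨⟨k, hk⟩, le_rfl, hbe.symm, hm⟩
    · obtain ⟨j, hj, h⟩ := ih (hF.vertex b ⟨k, hk⟩ m hm hb hbe)
      exact ⟨j, by omega, h⟩

/-- A path that does not annihilate `M` is a route: the images of an element under its right
subpaths lie in deeper and deeper layers, and each of them sits in a layer of the right vertex. -/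
theorem isRoute_of_smul_ne_zero {b : V} {q : Path (e 0) b} {m : M} (h : pathΛ I q • m ≠ 0) :
    IsRoute e q := by
  suffices h : ∃ i : Fin (l + 1), e i = b ∧ pathΛ I q • m ∈ F i ∧
      q.vertices.Sublist ((List.ofFn e).take (i + 1)) by
    obtain ⟨i, -, -, hi⟩ := h
    exact hi.trans (List.take_sublist _ _)
  induction q with
  | nil =>
    refine ⟨0, rfl, by simp [hF.zero], ?_⟩
    rw [List.ofFn_succ]
    simp
  | @cons b c q α ih =>
    have hw := h
    rw [pathΛ_cons, mul_smul] at hw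
    obtain ⟨i, -, him, his⟩ := ih fun h0 => hw (by rw [h0, smul_zero])
    have h1 := hF.arrow ⟨b, c, α⟩ i _ him
    rw [← mul_smul, ← pathΛ_cons] at h1
    obtain ⟨j, hij, hj, hjm⟩ := hF.exists_index (b := c) h
      (by rw [← mul_smul, vertexΛ_mul_pathΛ]) (by omega) h1
    refine ⟨j, hj, hjm, ?_⟩
    have hjl : (j : ℕ) < (List.ofFn e).length := by rw [List.length_ofFn]; omega
    have hjc : (List.ofFn e)[(j : ℕ)] = c := by rw [List.getElem_ofFn]; exact hj
    rw [Path.vertices_cons, List.concat_eq_append, List.take_succ_eq_append_getElem hjl]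
    rw [hjc]
    exact List.Sublist.append (his.trans (List.take_sublist_take_left hij)) (List.Sublist.refl _)

variable {z : M} (hspan : Submodule.span (Lam I) {z} = ⊤) (hz : vertexΛ I (e 0) • z = z)
include hspan hz

omit hF in
theorem exists_smul_eq (m : M) : ∃ x ∈ projΛ I (e 0), x • z = m := by
  obtain ⟨x, rfl⟩ := Submodule.mem_span_singleton.1 (hspan ▸ Submodule.mem_top : m ∈ _)
  exact ⟨x * vertexΛ I (e 0), mem_projΛ.2 ⟨x, rfl⟩, by rw [mul_smul, hz]⟩

variable {p : PathThrough e} (hp : ∃ m : M, pathΛ I (subpath p (Fin.last l)) • m ≠ 0)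
include hp

/-- If `p` does not annihilate `M`, then it does not annihilate any generator `z = e(0) z`: for a
path `q` of positive length, `p q z` lies in the layer `l + 1`, which is zero. -/
theorem mast_smul_ne_zero : pathΛ I (subpath p (Fin.last l)) • z ≠ 0 := by
  intro h0
  obtain ⟨m, hm⟩ := hp
  obtain ⟨x, hx, rfl⟩ := IsLayering.exists_smul_eq hspan hz m
  refine hm (projΛ_induction
    (P := fun x => pathΛ I (subpath p (Fin.last l)) • x • z = 0) hx (by simp) ?_ ?_ ?_)
  · intro x y hx hy
    rw [add_smul, smul_add, hx, hy, add_zero]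
  · intro c x hx
    rw [Algebra.smul_def, mul_smul, ← mul_smul, ← Algebra.commutes, mul_smul, hx, smul_zero]
  · intro b q
    cases q with
    | nil => exact (congrArg _ hz).trans h0
    | cons q α =>
      have h1 : pathΛ I (q.cons α) • z ∈ F 1 :=
        hF.antitone (by simp) (hF.pathΛ_smul_mem (q.cons α) (hF.zero ▸ Submodule.mem_top))
      have h2 := hF.pathΛ_smul_mem (subpath p (Fin.last l)) h1
      rwa [length_subpath, Fin.val_last, add_comm, hF.last, Submodule.mem_bot] at h2

theorem subpath_smul_notMem (i : Fin (l + 1)) : pathΛ I (subpath p i) • z ∉ F (i + 1) := by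
  induction i using Fin.reverseInduction with
  | last =>
    rw [Fin.val_last, hF.last, Submodule.mem_bot]
    exact hF.mast_smul_ne_zero hspan hz hp
  | cast i ih =>
    intro h
    apply ih
    rw [subpath_succ, pathΛ_cons, mul_smul]
    exact hF.arrow _ _ _ h

/-- The elements `p_i z` lie in different layers. -/
theorem linearIndependent_subpath_smul [Module K M] [IsScalarTower K (Lam I) M] :
    LinearIndependent K fun i => pathΛ I (subpath p i) • z := by
  rw [Fintype.linearIndependent_iff]
  intro c hc i
  induction i using WellFoundedLT.induction with
  | ind i ih =>
  by_contra hci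
  have hrest : ∑ j ∈ Finset.univ.erase i, c j • pathΛ I (subpath p j) • z ∈ F (i + 1) := by
    refine sum_mem fun j hj => ?_
    rcases lt_or_ge j i with hji | hij
    · rw [ih j hji, zero_smul]
      exact zero_mem _
    · have hlt : i < j := lt_of_le_of_ne hij (Finset.ne_of_mem_erase hj).symm
      refine ((F (i + 1)).restrictScalars K).smul_mem _ (hF.antitone (Fin.lt_def.1 hlt) ?_)
      simpa only [length_subpath, zero_add] using
        hF.pathΛ_smul_mem (subpath p j) (i := 0) (m := z) (hF.zero ▸ Submodule.mem_top)
  -- the first nonzero coefficient would put its `p_i z` into the next layer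
  rw [← Finset.add_sum_erase _ _ (Finset.mem_univ i), add_eq_zero_iff_eq_neg] at hc
  have hmem : c i • pathΛ I (subpath p i) • z ∈ (F (i + 1)).restrictScalars K :=
    hc ▸ neg_mem hrest
  exact hF.subpath_smul_notMem hspan hz hp i ((Submodule.smul_mem_iff _ hci).1 hmem)

end IsLayering
end Filtration
end Main

section Main
variable {K : Type u} [Field K] {V : Type v} [Fintype V] [DecidableEq V] [Quiver.{w} V]
variable {I : Ideal (PathAlgebra K V)} [I.IsTwoSided] {l : ℕ} {e : Fin (l + 1) → V}

/-! ### Modules described by coordinates, and the fibres of `Φ_p` -/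

section Describes
variable {M : Type*} [AddCommGroup M] [Module (Lam I) M] {p : PathThrough e}
  {k : DetourIndex I p → K}

/-- The relations attached to `k` hold for a top element described by `k`. -/
theorem smul_eq_zero_of_mem_relΛ {F : ℕ → Submodule (Lam I) M} (hF : IsLayering e F) {z : M}
    (hdet : ∀ δ : Detour I p, (arrowΛ I δ.1.1 * pathΛ I (subpath p δ.1.2)) • z =
      ∑ i : detourTargets e δ.1.1 δ.1.2, (k ⟨δ, i⟩ • pathΛ I (subpath p i.1)) • z)
    {x : Lam I} (hx : x ∈ relΛ I p k) : x • z = 0 := by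
  suffices h : relΛ I p k ≤ LinearMap.ker (LinearMap.toSpanSingleton (Lam I) M z) from h hx
  refine Submodule.span_le.2 ?_
  rintro _ (⟨δ, rfl⟩ | ⟨b, q, hq, rfl⟩)
  · rw [SetLike.mem_coe, LinearMap.mem_ker, LinearMap.toSpanSingleton_apply, sub_smul, hdet,
      Finset.sum_smul, sub_self]
  · by_contra h
    exact hq (hF.isRoute_of_smul_ne_zero h)

/-- A uniserial module with mast `p` has the basis `p_i z`, for each top element `z` as in the
description by coordinates `k`, and so it is presented by the relations attached to `k`. -/
theorem Describes.nonempty_equiv (hI : IsRelationIdeal I) (hU : IsUniserialWithMast I p M)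
    (hD : Describes I p k M) : Nonempty (PhiModule I p k ≃ₗ[Lam I] M) := by
  let _ : Module K M := Module.compHom M (algebraMap K (Lam I))
  have : IsScalarTower K (Lam I) M :=
    ⟨fun c x m => by rw [Algebra.smul_def, mul_smul]; rfl⟩
  obtain ⟨-, hc, hp⟩ := hU
  obtain ⟨F, hF⟩ := hc.exists_isLayering hI
  obtain ⟨z, hz, hspan, hdet⟩ := hD
  have hli := Fintype.linearIndependent_iff.1 (hF.linearIndependent_subpath_smul hspan hz hp)
  let f : projΛ I (e 0) →ₗ[Lam I] M :=
    LinearMap.toSpanSingleton (Lam I) M z ∘ₗ (projΛ I (e 0)).subtype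
  have hf : Function.Surjective f := fun m => by
    obtain ⟨x, hx, rfl⟩ := IsLayering.exists_smul_eq hspan hz m
    exact ⟨⟨x, hx⟩, rfl⟩
  have hker : (relΛ I p k).submoduleOf (projΛ I (e 0)) = LinearMap.ker f := by
    ext ⟨x, hx⟩
    refine ⟨fun h => smul_eq_zero_of_mem_relΛ hF hdet h, fun h => ?_⟩
    have hxz : x • z = 0 := h
    obtain ⟨c, hcx⟩ := exists_sub_sum_subpath_mem_relΛ k hx
    have h0 := smul_eq_zero_of_mem_relΛ hF hdet hcx
    rw [sub_smul, hxz, zero_sub, neg_eq_zero, Finset.sum_smul] at h0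
    have hc0 := hli c (by simpa only [smul_assoc] using h0)
    change x ∈ relΛ I p k
    simpa [hc0] using hcx
  exact ⟨Submodule.quotEquivOfEq _ _ hker ≪≫ₗ f.quotKerEquivOfSurjective hf⟩

theorem describes_phiModule (hI : IsRelationIdeal I) (hk : k ∈ VarV I p) :
    IsUniserialWithMast I p (PhiModule I p k) ∧ Describes I p k (PhiModule I p k) := by
  obtain ⟨M, _, _, hU, hD⟩ := hk
  obtain ⟨E⟩ := hD.nonempty_equiv hI hU
  refine ⟨hU.of_equiv E.symm, ?_⟩
  obtain ⟨z, hz, hspan, hdet⟩ := hD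
  refine ⟨E.symm z, by rw [← map_smul, hz], ?_, fun δ => ?_⟩
  · rw [← Set.image_singleton]
    have := (Submodule.map_span E.symm.toLinearMap {z}).symm
    rw [hspan, Submodule.map_top, LinearEquiv.range] at this
    exact this
  · rw [← map_smul, hdet, map_sum]
    simp only [map_smul]

/-- The vertices and arrows act on the basis `p_i z` through the matrices `repCoeff`. -/
theorem Describes.exists_represents (hI : IsRelationIdeal I) (hU : IsUniserialWithMast I p M)
    (hD : Describes I p k M) :
    ∃ φ : Lam I →ₐ[K] Matrix (Fin (l + 1)) (Fin (l + 1)) K,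
      Represents I φ (fun s => MvPolynomial.aeval k (repCoeff I p s)) ∧
        Nonempty (M ≃ₗ[Lam I] MatrixModule I φ) := by
  let _ : Module K M := Module.compHom M (algebraMap K (Lam I))
  have : IsScalarTower K (Lam I) M :=
    ⟨fun c x m => by rw [Algebra.smul_def, mul_smul]; rfl⟩
  obtain ⟨-, hc, hp⟩ := hU
  obtain ⟨F, hF⟩ := hc.exists_isLayering hI
  obtain ⟨z, hz, hspan, hdet⟩ := hD
  have hli := hF.linearIndependent_subpath_smul hspan hz hp
  have hspanK : ⊤ ≤ Submodule.span K (Set.range fun i => pathΛ I (subpath p i) • z) := fun m _ => by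
    obtain ⟨x, hx, rfl⟩ := IsLayering.exists_smul_eq hspan hz m
    obtain ⟨c, hcx⟩ := exists_sub_sum_subpath_mem_relΛ k hx
    have h0 := smul_eq_zero_of_mem_relΛ hF hdet hcx
    rw [sub_smul, sub_eq_zero, Finset.sum_smul] at h0
    rw [h0]
    exact sum_mem fun i _ => by
      rw [smul_assoc]
      exact Submodule.smul_mem _ _ (Submodule.subset_span ⟨i, rfl⟩)
  let b : Module.Basis (Fin (l + 1)) K M := Module.Basis.mk hli hspanK
  have hb : ∀ i, b i = pathΛ I (subpath p i) • z := fun i => Module.Basis.mk_apply _ _ i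
  let φ : Lam I →ₐ[K] Matrix (Fin (l + 1)) (Fin (l + 1)) K :=
    (LinearMap.toMatrixAlgEquiv b).toAlgHom.comp (Algebra.lsmul K K M)
  have hφ : ∀ x, φ x = LinearMap.toMatrix b b (Algebra.lsmul K K M x) := fun x => rfl
  refine ⟨φ, fun γ => ?_, ?_⟩
  · have hact : ∀ j, genΛ I γ • b j =
        ∑ i, MvPolynomial.aeval k (repCoeff I p (γ, i, j)) • b i := fun j => by
      rcases γ with a | α
      · have : genΛ I (Sum.inl a) • b j = if e j = a then b j else 0 := by
          rw [hb, ← mul_smul]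
          split_ifs with h
          · subst h
            exact congrArg (· • z) (vertexΛ_mul_pathΛ I _)
          · have h0 : genΛ I (Sum.inl a) * pathΛ I (subpath p j) = 0 := pathΛ_mul_of_ne I h _ _
            rw [h0, zero_smul]
        rw [this, Finset.sum_eq_single j]
        · by_cases h : e j = a <;> simp [repCoeff, h]
        · intro i _ hij
          simp [repCoeff, hij]
        · simp
      · have h0 := smul_eq_zero_of_mem_relΛ hF hdet (arrowΛ_mul_subpath_sub_mem_relΛ k α j)
        rw [sub_smul, sub_eq_zero, Finset.sum_smul, mul_smul] at h0
        simp only [smul_assoc] at h0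
        simp only [hb]
        exact h0
    ext i j
    rw [hφ, LinearMap.toMatrix_apply]
    change _ = b.repr (genΛ I γ • b j) i
    rw [hact, b.repr_sum_self]
    rfl
  · let E : M ≃ₗ[K] MatrixModule I φ := b.equivFun ≪≫ₗ (vec φ).symm
    refine ⟨{ E with map_smul' := fun x m => (vec φ).injective ?_ }⟩
    exact (LinearMap.toMatrix_mulVec_repr b b (Algebra.lsmul K K M x) m).symm

/-- The fibre of `Φ_p` is the preimage of a `GL`-orbit in `Rep 𝕊` under the polynomial map that is
given by `repCoeff`. -/
theorem isZariskiClosedIn_phiFibre [∀ a b : V, Finite (a ⟶ b)] (hI : IsRelationIdeal I)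
    (p : PathThrough e) (U : Type*) [AddCommGroup U] [Module (Lam I) U] :
    IsZariskiClosedIn (VarV I p) (PhiFibre I p U) := by
  rcases Set.eq_empty_or_nonempty (PhiFibre I p U) with h | ⟨k₀, hk₀, ⟨E₀⟩⟩
  · rw [h]
    exact isZariskiClosedIn_empty _
  have hrep : ∀ k ∈ VarV I p, ∃ φ : Lam I →ₐ[K] Matrix (Fin (l + 1)) (Fin (l + 1)) K,
      Represents I φ (fun s => MvPolynomial.aeval k (repCoeff I p s)) ∧
        Nonempty (PhiModule I p k ≃ₗ[Lam I] MatrixModule I φ) := fun k hk =>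
    (describes_phiModule hI hk).2.exists_represents hI (describes_phiModule hI hk).1
  have hS : ∀ k ∈ VarV I p, (fun s => MvPolynomial.aeval k (repCoeff I p s)) ∈ RepS I e :=
    fun k hk => by
      obtain ⟨φ, hφ, ⟨E⟩⟩ := hrep k hk
      obtain ⟨hu, hc, -⟩ := (describes_phiModule hI hk).1
      exact ⟨φ, hφ, hu.of_equiv E, hc.of_equiv E⟩
  obtain ⟨φ₀, hφ₀, ⟨S₀⟩⟩ := hrep k₀ hk₀
  convert (isZariskiClosedIn_orbitGL_inter_RepS hI e
    (fun s => MvPolynomial.aeval k₀ (repCoeff I p s))).preimage (repCoeff I p) hS using 1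
  ext k
  refine and_congr_right fun hk => ?_
  obtain ⟨φ, hφ, ⟨S⟩⟩ := hrep k hk
  rw [Set.mem_inter_iff, and_iff_left (hS k hk), mem_orbitGL_iff hφ₀ hφ]
  exact ⟨fun ⟨E⟩ => ⟨S₀.symm ≪≫ₗ E₀ ≪≫ₗ E.symm ≪≫ₗ S⟩,
    fun ⟨E⟩ => ⟨S ≪≫ₗ E.symm ≪≫ₗ S₀.symm ≪≫ₗ E₀⟩⟩

end Describes
end Main
end UniserialGeometry
end
open UniserialGeometry
theorem corollaryF {K : Type*} [Field K] [IsAlgClosed K]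
    {V : Type*} [Fintype V] [DecidableEq V] [Quiver V] [∀ a b : V, Finite (a ⟶ b)]
    (I : Ideal (PathAlgebra K V)) [I.IsTwoSided] (hI : IsRelationIdeal I)
    {l : ℕ} (e : Fin (l + 1) → V) :
    (∀ p : PathThrough e,
      (∀ k ∈ VarV I p, IsUniserialWithMast I p (PhiModule I p k)) ∧
      ∀ (U : Type*) [AddCommGroup U] [Module (Lam I) U], IsUniserialWithMast I p U →
        IsZariskiClosedIn (VarV I p) (PhiFibre I p U)) ∧
    ∀ x ∈ ModVar I (l + 1), IsZariskiClosedIn (RepS I e) (orbitGL x ∩ RepS I e) :=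
  ⟨fun p => ⟨fun _ hk => (describes_phiModule hI hk).1,
    fun U _ _ _ => isZariskiClosedIn_phiFibre hI p U⟩,
    fun x _ => isZariskiClosedIn_orbitGL_inter_RepS hI e x⟩
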